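/- Let $n$ be a positive integer, and let $h_1(x,y)=\operatorname{Re}((x+iy)^{2n})$ and $h_2(x,y)=\operatorname{Im}((x+iy)^{2n})$; these are harmonic homogeneous polynomials of degree $2n$. Let $\Lambda\subset\mathbb E^2$ be a (full-rank) lattice in the Euclidean plane which is integral, i.e. $\|\gamma\|^2\in\mathbb N$ for all $\gamma\in\Lambda$. Let $N$ be its level, i.e. the least positive integer $N$ such that $N\|v\|^2\in\mathbb Z$ for every $v\in\mathbb E^2$ with $2\langle v,\gamma\rangle\in\mathbb Z$ for all $\gamma\in\Lambda$ (equivalently, the least $N>0$ such that $N A^{-1}$ is an integral matrix with even diagonal, where $A=(2\langle\gamma_i,\gamma_j\rangle)$ for a $\mathbb Z$-basis $(\gamma_1,\gamma_2)$ of $\Lambda$). Let $k=\min\{\|\gamma\|^2 : 0\ne\gamma\in\Lambda\}$ be its first minimal length. For $\tau$ in the upper half plane put $q=\exp(2\pi i\tau)$, $$\Theta_{h,\Lambda}(\tau)=\sum_{\gamma\in\Lambda}h(\gamma)\,q^{\|\gamma\|^2},\qquad \Theta_{nn,\Lambda}=\Theta_{h_1,\Lambda}^2+\Theta_{h_2,\Lambda}^2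 ,$$ where the series $\Theta_{h_1,\Lambda}$ and $\Theta_{h_2,\Lambda}$ converge absolutely. Then: 1. $\Theta_{nn,\Lambda}$ is a modular form of weight $4n+2$ for $\Gamma_0(N)$ with trivial character (holomorphic on the upper half plane and at all cusps). 2. $\Theta_{nn,\Lambda}$ is $\mathrm O(2)$-invariant: $\Theta_{nn,\varphi(\Lambda)}=\Theta_{nn,\Lambda}$ for every $\varphi\in\mathrm O(2)$. 3. $\Theta_{nn,\Lambda}(\tau)=\sum_{m\ge 0}a_mq^m$ with $$a_m=\sum_{\substack{(\gamma,\delta)\in\Lambda\times\Lambda\\ \|\gamma\|^2+\|\delta\|^2=m}}\cos\bigl(2n\measuredangle(\gamma,\delta)\bigr)\,\|\gamma\|^{2n}\|\delta\|^{2n},$$ where each sum is finite and terms with $\gamma=0$ or $\delta=0$ are $0$. 4. The coefficients $a_m$ are integers, and $\sum_m a_mq^m$ lies in the ideal $(4q^{2k})=4q^{2k}\,\mathbb Z[[q]]$ of $\mathbb Z[[q]]$. -/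

import Mathlib

open scoped RealInnerProductSpace MatrixGroups

noncomputable section

namespace LatticeTheta

/-- The Euclidean plane. -/
abbrev E2 : Type := EuclideanSpace ℝ (Fin 2)

/-- A lattice in the plane is integral if the squared norms of its vectors are natural numbers. -/
def IsIntegralLattice (Λ : Submodule ℤ E2) : Prop :=
  ∀ γ ∈ Λ, ∃ m : ℕ, ‖γ‖ ^ 2 = (m : ℝ)

/-- The dual of a lattice for the polar form `2⟪v, w⟫ = ‖v + w‖² - ‖v‖² - ‖w‖²` of the
quadratic form `‖v‖²`. -/
def polarDual (Λ : Submodule ℤ E2) : Set E2 :=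
  {v | ∀ γ ∈ Λ, ∃ z : ℤ, 2 * ⟪v, γ⟫ = (z : ℝ)}

/-- `N` is the level of `Λ`: the least positive integer `N` such that `N‖v‖²` is an integer for all
`v` in the dual of `Λ`. In terms of the Gram matrix `A = (2⟪γᵢ, γⱼ⟫)` of a `ℤ`-basis (so that
`‖∑ xᵢγᵢ‖² = xᵗAx / 2`), the dual vectors have coordinates `A⁻¹y` with `y` integral and
`N‖v‖² = yᵗ(N A⁻¹)y / 2`, so this is the least `N > 0` for which `N A⁻¹` is integral with even
diagonal. -/
def HasLevel (Λ : Submodule ℤ E2) (N : ℕ) : Prop :=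
  IsLeast {M : ℕ | 0 < M ∧ ∀ v ∈ polarDual Λ, ∃ z : ℤ, (M : ℝ) * ‖v‖ ^ 2 = (z : ℝ)} N

/-- `k` is the first minimal length of `Λ`; the length of `γ` is the value `‖γ‖²` of the
quadratic form, not its square root. -/
def HasMinimalLength (Λ : Submodule ℤ E2) (k : ℕ) : Prop :=
  IsLeast {m : ℕ | ∃ γ ∈ Λ, γ ≠ 0 ∧ ‖γ‖ ^ 2 = (m : ℝ)} k

/-- `h` is given by a harmonic homogeneous polynomial of degree `d`. -/
def IsHarmonicHomogeneous (d : ℕ) (h : E2 → ℝ) : Prop :=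
  ∃ P : MvPolynomial (Fin 2) ℝ, P.IsHomogeneous d ∧
    MvPolynomial.pderiv 0 (MvPolynomial.pderiv 0 P) +
      MvPolynomial.pderiv 1 (MvPolynomial.pderiv 1 P) = 0 ∧
    ∀ v : E2, h v = MvPolynomial.eval (fun i => v i) P

/-- `h₁(x, y) = Re((x + iy)^(2n))`. -/
def h1 (n : ℕ) (v : E2) : ℝ := (((v 0 : ℂ) + Complex.I * (v 1 : ℂ)) ^ (2 * n)).re

/-- `h₂(x, y) = Im((x + iy)^(2n))`. -/
def h2 (n : ℕ) (v : E2) : ℝ := (((v 0 : ℂ) + Complex.I * (v 1 : ℂ)) ^ (2 * n)).im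

/-- The term `h(γ) q^(‖γ‖²)`, `q = exp(2πiτ)`, of the spherical theta series. -/
def thetaTerm (h : E2 → ℝ) (τ : UpperHalfPlane) (γ : E2) : ℂ :=
  (h γ : ℂ) * Complex.exp (2 * Real.pi * Complex.I * (τ : ℂ) * ((‖γ‖ ^ 2 : ℝ) : ℂ))

/-- The spherical theta function `Θ_{h,Λ}`. -/
def sphericalTheta (h : E2 → ℝ) (Λ : Submodule ℤ E2) (τ : UpperHalfPlane) : ℂ :=
  ∑' γ : Λ, thetaTerm h τ (γ : E2)

/-- `Θ_{nn,Λ} = Θ_{h₁,Λ}² + Θ_{h₂,Λ}²`. -/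
def thetaNN (n : ℕ) (Λ : Submodule ℤ E2) (τ : UpperHalfPlane) : ℂ :=
  sphericalTheta (h1 n) Λ τ ^ 2 + sphericalTheta (h2 n) Λ τ ^ 2

/-- The pairs `(γ, δ) ∈ Λ × Λ` with `‖γ‖² + ‖δ‖² = m`. -/
def pairsOfLength (Λ : Submodule ℤ E2) (m : ℕ) : Set (E2 × E2) :=
  {p | p.1 ∈ Λ ∧ p.2 ∈ Λ ∧ ‖p.1‖ ^ 2 + ‖p.2‖ ^ 2 = (m : ℝ)}

/-- `a_m = ∑ cos(2n∠(γ, δ)) ‖γ‖^(2n) ‖δ‖^(2n)` over the pairs with `‖γ‖² + ‖δ‖² = m`. -/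
def angleCoeff (n : ℕ) (Λ : Submodule ℤ E2) (m : ℕ) : ℝ :=
  ∑ᶠ p ∈ pairsOfLength Λ m,
    Real.cos (2 * n * InnerProductGeometry.angle p.1 p.2) * ‖p.1‖ ^ (2 * n) * ‖p.2‖ ^ (2 * n)

/-- The image `φ(Λ)` of a lattice under `φ ∈ O(2)`. -/
def rotate (φ : E2 ≃ₗᵢ[ℝ] E2) (Λ : Submodule ℤ E2) : Submodule ℤ E2 :=
  Λ.map (φ.toLinearEquiv.toLinearMap.restrictScalars ℤ)

end LatticeTheta

end

/-!
# Squared theta series of plane lattices with harmonic coefficients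

Identify the plane with `ℂ`. Then `Θ_{h₁} + i Θ_{h₂} = ∑ γ ^ (2n) q ^ |γ|²` is the theta series of
`Λ` weighted by a power, `Θ_{h₁} - i Θ_{h₂}` is the corresponding series of the conjugate lattice,
and `Θ_{nn,Λ}` is their product (`thetaNN_eq_planarTheta_mul`).

*Modularity.* Poisson summation for a Gaussian (`tsum_gaussTerm`) holds for complex shifts. Shifting
along an isotropic vector removes the quadratic term in the shift, so that comparing Taylor
coefficients in the length of the shift gives Poisson summation with the weight `γ ^ m`
(`tsum_pow_mul_gaussian`). Splitting the lattice into residue classes modulo `c` then gives the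
expansion of the theta series at the cusp `a / c` (`planarTheta_smul`), and in particular
boundedness at all cusps. For a matrix in `Γ₀(N)` all coefficients of this expansion reduce to one
Gauss sum of the norm form (`cuspSum_eq_binGaussSum`). The lower right entry of the matrix may be
replaced by a prime `p`, and the Gauss sum has square `p ^ 2`; so the theta series transforms with
a sign that depends on the norm form only (`exists_sign_planarTheta`). A lattice and its conjugate
have the same norm form, hence the signs cancel in the product (`IsNormForm.exists_modularForm`).

*Coefficients.* As `h₁(γ) h₁(δ) + h₂(γ) h₂(δ) = Re ((γ * conj δ) ^ (2n))` is
`cos (2n ∠(γ, δ)) |γ|^(2n) |δ|^(2n)`, the series `Θ_{nn,Λ}` is a sum over pairs of lattice vectors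
that involves only lengths and angles (`hasSum_thetaNN`); this gives both its invariance under
isometries and its `q`-expansion. For integral `Λ` twice each summand is an integer, being a power
sum of a complex number with integral trace and norm, and the summands with `γ = δ` are integers.
Changing the signs of `γ` and `δ` produces a factor `4`; in the remaining sum the pairs `(γ, δ)` and
`(δ, γ)` combine to integers (`exists_int_angleCoeff`). A nonzero summand has
`|γ|² + |δ|² ≥ 2k`.
-/

noncomputable section

namespace LatticeTheta

open scoped ModularForm

/-! ### Binary quadratic forms and convergence of Gaussian series -/

/-- The binary quadratic form `A x² + B x y + C y²` over any commutative ring. -/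
def binForm {R : Type*} [CommRing R] (A B C x y : R) : R := A * x ^ 2 + B * x * y + C * y ^ 2

lemma exists_binForm_ge {A B C : ℝ} (hA : 0 < A) (hD : 0 < 4 * A * C - B ^ 2) :
    ∃ κ : ℝ, 0 < κ ∧ ∀ x y : ℝ, κ * (x ^ 2 + y ^ 2) ≤ binForm A B C x y := by
  have hC : 0 < C := by
    by_contra h
    push Not at h
    nlinarith [sq_nonneg B]
  have hAC : 0 < A + C := by positivity
  -- the smaller eigenvalue is the determinant divided by the larger one, and the latter is at most
  -- the trace
  refine ⟨(4 * A * C - B ^ 2) / (4 * (A + C)), by positivity, fun x y => ?_⟩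
  set κ := (4 * A * C - B ^ 2) / (4 * (A + C)) with hκ
  have hk : κ * (4 * (A + C)) = 4 * A * C - B ^ 2 := by
    rw [hκ]; field_simp
  have hAk : 0 < A - κ := by
    rw [sub_pos, hκ, div_lt_iff₀ (by positivity)]
    nlinarith [sq_nonneg B, mul_pos hA hA]
  have key : 0 ≤ 4 * (A - κ) * (binForm A B C x y - κ * (x ^ 2 + y ^ 2)) := by
    have : 4 * (A - κ) * (binForm A B C x y - κ * (x ^ 2 + y ^ 2)) =
        (2 * (A - κ) * x + B * y) ^ 2 + (2 * κ * y) ^ 2 := by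
      unfold binForm
      linear_combination (-y ^ 2) * hk
    rw [this]; positivity
  have := nonneg_of_mul_nonneg_right key (by positivity : 0 < 4 * (A - κ))
  linarith

lemma summable_exp_linear_sub_sq (S : ℝ) {κ : ℝ} (hκ : 0 < κ) :
    Summable fun n : ℤ => Real.exp (S * |(n : ℝ)| - κ * (n : ℝ) ^ 2) := by
  have := summable_pow_mul_jacobiTheta₂_term_bound (S / (2 * Real.pi))
    (div_pos hκ Real.pi_pos) 0
  refine this.congr fun n => ?_
  rw [pow_zero, one_mul]
  congr 1
  field_simp
  push_cast
  ring

lemma summable_exp_linear_sub_binForm {A B C : ℝ} (hA : 0 < A) (hD : 0 < 4 * A * C - B ^ 2)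
    (c S : ℝ) {κ : ℝ} (hκ : 0 < κ) :
    Summable fun p : ℤ × ℤ =>
      Real.exp (c + S * (|(p.1 : ℝ)| + |(p.2 : ℝ)|) - κ * binForm A B C p.1 p.2) := by
  obtain ⟨μ, hμ, hle⟩ := exists_binForm_ge hA hD
  have h1 := summable_exp_linear_sub_sq S (mul_pos hκ hμ)
  have h2 := (h1.mul_of_nonneg h1 (fun _ => (Real.exp_pos _).le)
    (fun _ => (Real.exp_pos _).le)).mul_left (Real.exp c)
  refine h2.of_nonneg_of_le (fun _ => (Real.exp_pos _).le) fun p => ?_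
  rw [← Real.exp_add, ← Real.exp_add]
  apply Real.exp_le_exp.mpr
  nlinarith [mul_le_mul_of_nonneg_left (hle p.1 p.2) hκ.le]

/-- A family on `ℤ × ℤ` that is dominated by a Gaussian times a linear exponential is absolutely
summable. -/
lemma summable_norm_of_le_gaussian {A B C : ℝ} (hA : 0 < A) (hD : 0 < 4 * A * C - B ^ 2)
    {f : ℤ × ℤ → ℂ} (c S : ℝ) {κ : ℝ} (hκ : 0 < κ)
    (hf : ∀ p, ‖f p‖ ≤
      Real.exp (c + S * (|(p.1 : ℝ)| + |(p.2 : ℝ)|) - κ * binForm A B C p.1 p.2)) :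
    Summable fun p => ‖f p‖ :=
  (summable_exp_linear_sub_binForm hA hD c S hκ).of_nonneg_of_le (fun _ => norm_nonneg _) hf

lemma pow_le_factorial_mul_exp {t : ℝ} (ht : 0 ≤ t) (m : ℕ) :
    t ^ m ≤ (m.factorial : ℝ) * Real.exp t := by
  have := Real.pow_div_factorial_le_exp t ht m
  rwa [div_le_iff₀' (by positivity)] at this

/-! ### Two-dimensional Poisson summation for Gaussians -/

/-- The binary theta series with characteristics: its terms are the Gaussian
`exp (2πi (τ q(x, y) + x z₁ + y z₂))`. -/
def gaussTerm (A B C : ℝ) (τ z₁ z₂ : ℂ) (p : ℤ × ℤ) : ℂ :=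
  Complex.exp (2 * Real.pi * Complex.I *
    (τ * binForm (A : ℂ) B C p.1 p.2 + p.1 * z₁ + p.2 * z₂))

lemma binForm_ofReal (A B C x y : ℝ) :
    ((binForm A B C x y : ℝ) : ℂ) = binForm (A : ℂ) B C x y := by
  simp [binForm]

lemma norm_exp_two_pi_I_mul (z : ℂ) :
    ‖Complex.exp (2 * Real.pi * Complex.I * z)‖ = Real.exp (-(2 * Real.pi * z.im)) := by
  rw [Complex.norm_exp]
  simp [Complex.mul_re, Complex.mul_im]

lemma summable_gaussTerm {A B C : ℝ} (hA : 0 < A) (hD : 0 < 4 * A * C - B ^ 2) {τ : ℂ}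
    (hτ : 0 < τ.im) (z₁ z₂ : ℂ) : Summable fun p => ‖gaussTerm A B C τ z₁ z₂ p‖ := by
  refine summable_norm_of_le_gaussian hA hD 0 (2 * Real.pi * (|z₁.im| + |z₂.im|))
    (mul_pos Real.two_pi_pos hτ) fun p => ?_
  rw [gaussTerm, norm_exp_two_pi_I_mul]
  apply Real.exp_le_exp.mpr
  have him : (τ * binForm (A : ℂ) B C p.1 p.2 + p.1 * z₁ + p.2 * z₂).im =
      τ.im * binForm A B C p.1 p.2 + p.1 * z₁.im + p.2 * z₂.im := by
    have := binForm_ofReal A B C p.1 p.2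
    push_cast at this
    rw [← this]
    simp [Complex.mul_im]
  rw [him]
  have h1 : -((p.1 : ℝ) * z₁.im) ≤ |(p.1 : ℝ)| * |z₁.im| := by
    rw [← abs_mul]; exact neg_le_abs _
  have h2 : -((p.2 : ℝ) * z₂.im) ≤ |(p.2 : ℝ)| * |z₂.im| := by
    rw [← abs_mul]; exact neg_le_abs _
  have h3 : |(p.1 : ℝ)| * |z₁.im| + |(p.2 : ℝ)| * |z₂.im| ≤
      (|z₁.im| + |z₂.im|) * (|(p.1 : ℝ)| + |(p.2 : ℝ)|) := by
    have := mul_nonneg (abs_nonneg (p.1 : ℝ)) (abs_nonneg z₂.im)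
    have := mul_nonneg (abs_nonneg (p.2 : ℝ)) (abs_nonneg z₁.im)
    nlinarith
  nlinarith [Real.two_pi_pos, mul_le_mul_of_nonneg_left (h3) Real.two_pi_pos.le,
    mul_le_mul_of_nonneg_left (h1) Real.two_pi_pos.le,
    mul_le_mul_of_nonneg_left (h2) Real.two_pi_pos.le]

lemma neg_I_mul_cpow_half_mul_self {a b : ℝ} (ha : 0 < a) (hb : 0 < b) {τ : ℂ} (hτ : 0 < τ.im) :
    (-Complex.I * (a * τ)) ^ (1 / 2 : ℂ) * (-Complex.I * (b * τ)) ^ (1 / 2 : ℂ) =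
      Real.sqrt (a * b) * (-Complex.I * τ) := by
  have hτ0 : -Complex.I * τ ≠ 0 := by
    refine mul_ne_zero (neg_ne_zero.mpr Complex.I_ne_zero) ?_
    rintro rfl
    simp at hτ
  have key : ∀ c : ℝ, 0 < c → (-Complex.I * (c * τ)) ^ (1 / 2 : ℂ) =
      Real.sqrt c * (-Complex.I * τ) ^ (1 / 2 : ℂ) := by
    intro c hc
    have hc' : (c : ℂ) ≠ 0 := Complex.ofReal_ne_zero.mpr hc.ne'
    rw [show -Complex.I * (c * τ) = (c : ℂ) * (-Complex.I * τ) by ring,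
      Real.sqrt_eq_rpow, Complex.ofReal_cpow hc.le, Complex.cpow_def_of_ne_zero (mul_ne_zero hc' hτ0),
      Complex.log_ofReal_mul hc hτ0, add_mul, Complex.exp_add,
      Complex.cpow_def_of_ne_zero hc', Complex.cpow_def_of_ne_zero hτ0, Complex.ofReal_log hc.le]
    norm_num
  rw [key a ha, key b hb, mul_mul_mul_comm, ← Complex.cpow_add _ _ hτ0, Real.sqrt_mul ha.le]
  norm_num

/-- Poisson summation for the Gaussian of a positive definite binary form: both variables are
summed with the one-dimensional functional equation, completing the square in between. -/
theorem tsum_gaussTerm {A B C : ℝ} (hA : 0 < A) (hD : 0 < 4 * A * C - B ^ 2) {τ : ℂ}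
    (hτ : 0 < τ.im) (z₁ z₂ : ℂ) :
    ∑' p, gaussTerm A B C τ z₁ z₂ p =
      1 / (Real.sqrt (4 * A * C - B ^ 2) * (-Complex.I * τ)) * ∑' p : ℤ × ℤ,
        Complex.exp (2 * Real.pi * Complex.I *
          (-(binForm (C : ℂ) (-B) A (z₁ - p.1) (z₂ - p.2) / ((4 * A * C - B ^ 2 : ℝ) * τ)))) := by
  set D := 4 * A * C - B ^ 2 with hDdef
  have hτ0 : τ ≠ 0 := by rintro rfl; simp at hτ
  have hA0 : (A : ℂ) ≠ 0 := Complex.ofReal_ne_zero.mpr hA.ne'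
  have hD0 : (D : ℂ) ≠ 0 := Complex.ofReal_ne_zero.mpr hD.ne'
  have hDc : (D : ℂ) = 4 * A * C - B ^ 2 := by rw [hDdef]; push_cast; ring
  have hinvim : 0 < (-1 / (((2 * A : ℝ) : ℂ) * τ)).im := by
    rw [neg_div, Complex.neg_im, one_div, Complex.inv_im, Complex.im_ofReal_mul, neg_div, neg_neg]
    have : 0 < Complex.normSq (((2 * A : ℝ) : ℂ) * τ) := by
      rw [Complex.normSq_pos]
      exact mul_ne_zero (Complex.ofReal_ne_zero.mpr (by positivity)) hτ0
    positivity
  have hDim : 0 < (((D / (2 * A) : ℝ) : ℂ) * τ).im := by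
    rw [Complex.im_ofReal_mul]; positivity
  -- the family obtained by summing over the first variable only
  set H : ℤ × ℤ → ℂ := fun p => Complex.exp (2 * Real.pi * Complex.I *
    (-(τ * B * p.2 + z₁ - p.1) ^ 2 / (4 * A * τ) + τ * C * p.2 ^ 2 + p.2 * z₂)) with hH
  have hHsum : Summable H := by
    have s1 := (summable_jacobiTheta₂_term_iff (z₁ / (2 * A * τ)) _).mpr hinvim
    have s2 := (summable_jacobiTheta₂_term_iff (z₂ - B * z₁ / (2 * A)) _).mpr hDim
    have s3 := (s1.norm.mul_of_nonneg s2.norm (fun _ => norm_nonneg _)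
      (fun _ => norm_nonneg _)).mul_left
        ‖Complex.exp (2 * Real.pi * Complex.I * (-(z₁ ^ 2 / (4 * A * τ))))‖
    refine Summable.of_norm (s3.congr fun p => ?_)
    -- the remaining cross term is unimodular
    have hu : ‖Complex.exp (2 * Real.pi * Complex.I *
        ((B * p.1 * p.2 / (2 * A) : ℝ) : ℂ))‖ = 1 := by
      rw [norm_exp_two_pi_I_mul, Complex.ofReal_im]; simp
    rw [← norm_mul, ← norm_mul, ← mul_one ‖_‖, ← hu, ← norm_mul, jacobiTheta₂_term,
      jacobiTheta₂_term, ← Complex.exp_add, ← Complex.exp_add, ← Complex.exp_add]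
    congr 2
    push_cast
    rw [hDc]
    field_simp
    ring
  have hF := (summable_gaussTerm hA hD hτ z₁ z₂).of_norm
  have step1 : ∀ y : ℤ, ∑' x : ℤ, gaussTerm A B C τ z₁ z₂ (x, y) =
      1 / (-Complex.I * ((2 * A : ℝ) * τ)) ^ (1 / 2 : ℂ) * ∑' x : ℤ, H (x, y) := by
    intro y
    have e1 : ∑' x : ℤ, gaussTerm A B C τ z₁ z₂ (x, y) =
        Complex.exp (2 * Real.pi * Complex.I * (τ * C * y ^ 2 + y * z₂)) *
          jacobiTheta₂ (τ * B * y + z₁) ((2 * A : ℝ) * τ) := by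
      rw [jacobiTheta₂, ← tsum_mul_left]
      refine tsum_congr fun x => ?_
      rw [gaussTerm, jacobiTheta₂_term, ← Complex.exp_add]
      congr 1
      simp only [binForm]
      push_cast
      ring
    rw [e1, jacobiTheta₂_functional_equation, jacobiTheta₂, ← tsum_mul_left, ← tsum_mul_left,
      ← tsum_mul_left]
    refine tsum_congr fun x => ?_
    rw [jacobiTheta₂_term, hH]
    simp only
    rw [mul_left_comm, mul_assoc, mul_assoc, ← Complex.exp_add, mul_comm (Complex.exp _),
      mul_assoc, ← Complex.exp_add]
    congr 2
    push_cast
    field_simp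
    ring
  have step2 : ∀ x : ℤ, ∑' y : ℤ, H (x, y) =
      1 / (-Complex.I * ((D / (2 * A) : ℝ) * τ)) ^ (1 / 2 : ℂ) * ∑' y : ℤ,
        Complex.exp (2 * Real.pi * Complex.I *
          (-(binForm (C : ℂ) (-B) A (z₁ - x) (z₂ - y) / ((D : ℝ) * τ)))) := by
    intro x
    have e1 : ∑' y : ℤ, H (x, y) =
        Complex.exp (2 * Real.pi * Complex.I * (-(z₁ - x) ^ 2 / (4 * A * τ))) *
          jacobiTheta₂ (z₂ - B * (z₁ - x) / (2 * A)) ((D / (2 * A) : ℝ) * τ) := by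
      rw [jacobiTheta₂, ← tsum_mul_left]
      refine tsum_congr fun y => ?_
      simp only [hH]
      rw [jacobiTheta₂_term, ← Complex.exp_add]
      congr 1
      push_cast
      rw [hDc]
      field_simp
      ring
    rw [e1, jacobiTheta₂_functional_equation, jacobiTheta₂, ← tsum_mul_left, ← tsum_mul_left,
      ← tsum_mul_left]
    refine tsum_congr fun y => ?_
    rw [jacobiTheta₂_term, mul_left_comm, mul_assoc, mul_assoc, ← Complex.exp_add,
      mul_comm (Complex.exp _), mul_assoc, ← Complex.exp_add]
    congr 2
    simp only [binForm]
    push_cast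
    have hC : (C : ℂ) = (D + B ^ 2) / (4 * A) := by rw [hDc]; field_simp; ring
    rw [hC]
    field_simp
    ring
  have hK : 1 / (-Complex.I * ((2 * A : ℝ) * τ)) ^ (1 / 2 : ℂ) *
      (1 / (-Complex.I * ((D / (2 * A) : ℝ) * τ)) ^ (1 / 2 : ℂ)) =
      1 / (Real.sqrt D * (-Complex.I * τ)) := by
    rw [one_div_mul_one_div, neg_I_mul_cpow_half_mul_self (by positivity) (by positivity) hτ,
      mul_div_cancel₀ _ (by positivity)]
  have hRsum : Summable fun p : ℤ × ℤ => Complex.exp (2 * Real.pi * Complex.I *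
      (-(binForm (C : ℂ) (-B) A (z₁ - p.1) (z₂ - p.2) / ((D : ℝ) * τ)))) := by
    have hC : 0 < C := by
      by_contra h
      push Not at h
      nlinarith [sq_nonneg B]
    have hτ' : 0 < (-1 / τ).im := by
      rw [neg_div, Complex.neg_im, one_div, Complex.inv_im, neg_div, neg_neg]
      have : 0 < Complex.normSq τ := Complex.normSq_pos.mpr hτ0
      positivity
    have hD' : 0 < 4 * (C / D) * (A / D) - (-B / D) ^ 2 := by
      have : 4 * (C / D) * (A / D) - (-B / D) ^ 2 = 1 / D := by
        field_simp
        rw [hDdef]; ring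
      rw [this]; positivity
    refine ((summable_gaussTerm (div_pos hC hD) hD' hτ' ((2 * C * z₁ - B * z₂) / (D * τ))
      ((2 * A * z₂ - B * z₁) / (D * τ))).of_norm.mul_left (Complex.exp (2 * Real.pi * Complex.I *
        (-(binForm (C : ℂ) (-B) A z₁ z₂ / (D * τ)))))).congr fun p => ?_
    rw [gaussTerm, ← Complex.exp_add]
    congr 1
    simp only [binForm]
    push_cast
    field_simp
    ring
  have hF' : Summable fun p : ℤ × ℤ => gaussTerm A B C τ z₁ z₂ (p.2, p.1) :=
    (Equiv.prodComm ℤ ℤ).summable_iff.mpr hF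
  have hcomm : ∑' (y : ℤ) (x : ℤ), H (x, y) = ∑' (x : ℤ) (y : ℤ), H (x, y) :=
    Summable.tsum_comm (f := fun x y => H (x, y)) hHsum
  rw [← (Equiv.prodComm ℤ ℤ).tsum_eq]
  simp only [Equiv.prodComm_apply, Prod.swap]
  rw [hF'.tsum_prod, tsum_congr step1, tsum_mul_left, hcomm, tsum_congr step2, tsum_mul_left,
    ← mul_assoc, hK, hRsum.tsum_prod]

/-! ### Harmonic polynomial weights by comparing power series -/

lemma hasSum_pow_of_tsum_mul_exp {ι : Type*} {w X : ι → ℂ}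
    (h : ∀ R : ℝ, Summable fun i => ‖w i‖ * Real.exp (R * ‖X i‖)) (t : ℂ) :
    HasSum (fun m : ℕ => t ^ m * ((∑' i, w i * X i ^ m) / m.factorial))
      (∑' i, w i * Complex.exp (t * X i)) := by
  have hexp : ∀ z : ℂ, HasSum (fun m : ℕ => z ^ m / m.factorial) (Complex.exp z) := fun z => by
    simpa [Complex.exp_eq_exp_ℂ] using NormedSpace.expSeries_div_hasSum_exp z
  have hexpR : ∀ z : ℝ, HasSum (fun m : ℕ => z ^ m / m.factorial) (Real.exp z) := fun z => by
    simpa [Real.exp_eq_exp_ℝ] using NormedSpace.expSeries_div_hasSum_exp z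
  have hs : Summable fun q : ι × ℕ => w q.1 * ((t * X q.1) ^ q.2 / q.2.factorial) := by
    apply Summable.of_norm
    have hrow : ∀ i, HasSum (fun m : ℕ => ‖w i * ((t * X i) ^ m / m.factorial)‖)
        (‖w i‖ * Real.exp (‖t‖ * ‖X i‖)) := fun i => by
      simpa [norm_mul, norm_div, norm_pow] using (hexpR (‖t‖ * ‖X i‖)).mul_left ‖w i‖
    rw [summable_prod_of_nonneg (fun _ => norm_nonneg _)]
    exact ⟨fun i => (hrow i).summable, (h ‖t‖).congr fun i => (hrow i).tsum_eq.symm⟩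
  have h1 := hs.hasSum
  have h2 : ∑' q : ι × ℕ, w q.1 * ((t * X q.1) ^ q.2 / q.2.factorial) =
      ∑' i, w i * Complex.exp (t * X i) := by
    rw [hs.tsum_prod]
    exact tsum_congr fun i => ((hexp (t * X i)).mul_left (w i)).tsum_eq
  rw [h2] at h1
  have h3 := ((Equiv.prodComm ℕ ι).hasSum_iff.mpr h1)
  have hs' : Summable fun q : ℕ × ι => w q.2 * ((t * X q.2) ^ q.1 / q.1.factorial) :=
    (Equiv.prodComm ℕ ι).summable_iff.mpr hs
  have h4 := h3.prod_fiberwise (fun m => (hs'.prod_factor m).hasSum)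
  convert h4 using 1
  funext m
  rw [mul_div_assoc', ← tsum_mul_left, ← tsum_div_const]
  refine tsum_congr fun i => ?_
  rw [mul_pow]
  ring

/-- If two absolutely convergent exponential sums agree as functions of the frequency, then so do
their moments, which are the Taylor coefficients at `0`. -/
lemma tsum_mul_pow_eq_of_tsum_mul_exp_eq {ι κ : Type*} {w X : ι → ℂ} {w' X' : κ → ℂ}
    (h : ∀ R : ℝ, Summable fun i => ‖w i‖ * Real.exp (R * ‖X i‖))
    (h' : ∀ R : ℝ, Summable fun i => ‖w' i‖ * Real.exp (R * ‖X' i‖))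
    (heq : ∀ t : ℂ, ∑' i, w i * Complex.exp (t * X i) = ∑' i, w' i * Complex.exp (t * X' i))
    (m : ℕ) : ∑' i, w i * X i ^ m = ∑' i, w' i * X' i ^ m := by
  set F : ℂ → ℂ := fun t => ∑' i, w i * Complex.exp (t * X i) with hF
  have key : ∀ c : ℕ → ℂ, (∀ t : ℂ, HasSum (fun m : ℕ => t ^ m * c m) (F t)) →
      HasFPowerSeriesAt F (FormalMultilinearSeries.ofScalars ℂ c) 0 := by
    intro c hc
    rw [hasFPowerSeriesAt_iff]
    refine Filter.Eventually.of_forall fun t => ?_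
    simpa [FormalMultilinearSeries.coeff_ofScalars] using hc t
  have k1 := key _ (hasSum_pow_of_tsum_mul_exp h)
  have k2 := key _ (fun t => by
    have := hasSum_pow_of_tsum_mul_exp h' t
    rwa [← heq t] at this)
  have := k1.eq_formalMultilinearSeries k2
  have := congrArg (fun p => p.coeff m) this
  simp only [FormalMultilinearSeries.coeff_ofScalars] at this
  exact (div_left_inj' (Nat.cast_ne_zero.mpr m.factorial_ne_zero)).mp this

/-- `A x² + B x y + C y²` is the squared norm of `x e₁ + y e₂`, and `e₁, e₂` are linearly
independent over `ℝ` (positive discriminant `4AC - B²`). -/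
structure IsNormForm (e₁ e₂ : ℂ) (A B C : ℝ) : Prop where
  left : (A : ℂ) = e₁ * starRingEnd ℂ e₁
  mid : (B : ℂ) = e₁ * starRingEnd ℂ e₂ + starRingEnd ℂ e₁ * e₂
  right : (C : ℂ) = e₂ * starRingEnd ℂ e₂
  disc_pos : 0 < 4 * A * C - B ^ 2

namespace IsNormForm

variable {e₁ e₂ : ℂ} {A B C : ℝ}

lemma left_pos (h : IsNormForm e₁ e₂ A B C) : 0 < A := by
  have h1 : A = Complex.normSq e₁ := by
    have := h.left
    rw [Complex.mul_conj] at this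
    exact_mod_cast this
  refine lt_of_le_of_ne (h1 ▸ Complex.normSq_nonneg _) fun h0 => ?_
  have := h.disc_pos
  rw [← h0] at this
  nlinarith [sq_nonneg B]

lemma binForm_eq (h : IsNormForm e₁ e₂ A B C) (x y : ℂ) : binForm (A : ℂ) B C x y =
    (x * e₁ + y * e₂) * (x * starRingEnd ℂ e₁ + y * starRingEnd ℂ e₂) := by
  rw [binForm, h.left, h.mid, h.right]
  ring

lemma sq_norm (h : IsNormForm e₁ e₂ A B C) (x y : ℝ) :
    ‖(x : ℂ) * e₁ + y * e₂‖ ^ 2 = binForm A B C x y := by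
  apply Complex.ofReal_injective
  rw [binForm_ofReal, h.binForm_eq, ← Complex.normSq_eq_norm_sq, ← Complex.mul_conj]
  simp

lemma conj (h : IsNormForm e₁ e₂ A B C) :
    IsNormForm (starRingEnd ℂ e₁) (starRingEnd ℂ e₂) A B C where
  left := by rw [h.left, Complex.conj_conj, mul_comm]
  mid := by rw [h.mid, Complex.conj_conj, Complex.conj_conj]; ring
  right := by rw [h.right, Complex.conj_conj, mul_comm]
  disc_pos := h.disc_pos

/-- Four times the square of the oriented covolume, up to sign, is the discriminant. -/
lemma disc_eq (h : IsNormForm e₁ e₂ A B C) : ((4 * A * C - B ^ 2 : ℝ) : ℂ) =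
    -(e₁ * starRingEnd ℂ e₂ - starRingEnd ℂ e₁ * e₂) ^ 2 := by
  push_cast
  rw [h.left, h.mid, h.right]
  ring

lemma covol_ne_zero (h : IsNormForm e₁ e₂ A B C) :
    e₁ * starRingEnd ℂ e₂ - starRingEnd ℂ e₁ * e₂ ≠ 0 := by
  intro h0
  have := h.disc_eq
  rw [h0] at this
  rw [zero_pow two_ne_zero, neg_zero, Complex.ofReal_eq_zero] at this
  exact h.disc_pos.ne' this

/-- The first vector of the basis dual to `e₁, e₂` for the polar form. -/
def _root_.LatticeTheta.dualLeft (e₁ e₂ : ℂ) : ℂ :=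
  -e₂ / (e₁ * starRingEnd ℂ e₂ - starRingEnd ℂ e₁ * e₂)

/-- The second vector of the basis dual to `e₁, e₂` for the polar form. -/
def _root_.LatticeTheta.dualRight (e₁ e₂ : ℂ) : ℂ :=
  e₁ / (e₁ * starRingEnd ℂ e₂ - starRingEnd ℂ e₁ * e₂)

/-- The norm form of the dual basis. -/
lemma dual (h : IsNormForm e₁ e₂ A B C) :
    IsNormForm (dualLeft e₁ e₂) (dualRight e₁ e₂)
      (C / (4 * A * C - B ^ 2)) (-B / (4 * A * C - B ^ 2)) (A / (4 * A * C - B ^ 2)) := by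
  have hne := h.covol_ne_zero
  have hc : starRingEnd ℂ (e₁ * starRingEnd ℂ e₂ - starRingEnd ℂ e₁ * e₂) =
      -(e₁ * starRingEnd ℂ e₂ - starRingEnd ℂ e₁ * e₂) := by
    simp only [map_sub, map_mul, Complex.conj_conj]
    ring
  refine ⟨?_, ?_, ?_, ?_⟩
  · rw [Complex.ofReal_div, h.disc_eq, h.right, dualLeft, map_div₀, hc, map_neg]
    field_simp
  · rw [Complex.ofReal_div, h.disc_eq, Complex.ofReal_neg, h.mid, dualLeft, dualRight, map_div₀,
      map_div₀, hc, map_neg]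
    field_simp
    ring
  · rw [Complex.ofReal_div, h.disc_eq, h.left, dualRight, map_div₀, hc]
    field_simp
  · have hD := h.disc_pos
    have : 4 * (C / (4 * A * C - B ^ 2)) * (A / (4 * A * C - B ^ 2)) -
        (-B / (4 * A * C - B ^ 2)) ^ 2 = 1 / (4 * A * C - B ^ 2) := by
      field_simp
    rw [this]; positivity

lemma summable_exp_mul_exp_norm (h : IsNormForm e₁ e₂ A B C) {κ : ℝ} (hκ : 0 < κ) (R r₁ r₂ : ℝ) :
    Summable fun p : ℤ × ℤ => Real.exp (-(κ * binForm A B C (r₁ + p.1) (r₂ + p.2))) *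
      Real.exp (R * ‖((r₁ + p.1 : ℝ) : ℂ) * e₁ + ((r₂ + p.2 : ℝ) : ℂ) * e₂‖) := by
  have hA := h.left_pos
  set S₁ := |2 * A * r₁ + B * r₂| + |B * r₁ + 2 * C * r₂| with hS₁
  set S₂ := ‖e₁‖ + ‖e₂‖ with hS₂
  refine (summable_exp_linear_sub_binForm hA h.disc_pos (|R| * ((|r₁| + |r₂|) * S₂))
    (κ * S₁ + |R| * S₂) hκ).of_nonneg_of_le (fun _ => by positivity) fun p => ?_
  rw [← Real.exp_add]
  apply Real.exp_le_exp.mpr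
  set x := (p.1 : ℝ)
  set y := (p.2 : ℝ)
  have hr : 0 ≤ binForm A B C r₁ r₂ := by rw [← h.sq_norm]; positivity
  have h1 : binForm A B C (r₁ + x) (r₂ + y) = binForm A B C r₁ r₂ + binForm A B C x y +
      ((2 * A * r₁ + B * r₂) * x + (B * r₁ + 2 * C * r₂) * y) := by
    simp only [binForm]; ring
  have h2 : -(S₁ * (|x| + |y|)) ≤ (2 * A * r₁ + B * r₂) * x + (B * r₁ + 2 * C * r₂) * y := by
    have a1 := neg_abs_le ((2 * A * r₁ + B * r₂) * x)
    have a2 := neg_abs_le ((B * r₁ + 2 * C * r₂) * y)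
    rw [abs_mul] at a1 a2
    have := mul_nonneg (abs_nonneg (2 * A * r₁ + B * r₂)) (abs_nonneg y)
    have := mul_nonneg (abs_nonneg (B * r₁ + 2 * C * r₂)) (abs_nonneg x)
    rw [hS₁]
    nlinarith
  have h3 : ‖((r₁ + x : ℝ) : ℂ) * e₁ + ((r₂ + y : ℝ) : ℂ) * e₂‖ ≤
      (|r₁| + |r₂|) * S₂ + S₂ * (|x| + |y|) := by
    refine (norm_add_le _ _).trans ?_
    rw [norm_mul, norm_mul, Complex.norm_real, Complex.norm_real, Real.norm_eq_abs,
      Real.norm_eq_abs, hS₂]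
    have a1 := mul_le_mul_of_nonneg_right (abs_add_le r₁ x) (norm_nonneg e₁)
    have a2 := mul_le_mul_of_nonneg_right (abs_add_le r₂ y) (norm_nonneg e₂)
    have := mul_nonneg (abs_nonneg r₁) (norm_nonneg e₂)
    have := mul_nonneg (abs_nonneg x) (norm_nonneg e₂)
    have := mul_nonneg (abs_nonneg r₂) (norm_nonneg e₁)
    have := mul_nonneg (abs_nonneg y) (norm_nonneg e₁)
    nlinarith
  have h4 : R * ‖((r₁ + x : ℝ) : ℂ) * e₁ + ((r₂ + y : ℝ) : ℂ) * e₂‖ ≤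
      |R| * ((|r₁| + |r₂|) * S₂ + S₂ * (|x| + |y|)) :=
    (mul_le_mul_of_nonneg_right (le_abs_self R) (norm_nonneg _)).trans
      (mul_le_mul_of_nonneg_left h3 (abs_nonneg R))
  have h5 : -(κ * binForm A B C (r₁ + x) (r₂ + y)) ≤
      κ * (S₁ * (|x| + |y|)) - κ * binForm A B C x y := by
    rw [h1]
    nlinarith [mul_le_mul_of_nonneg_left h2 hκ.le, mul_nonneg hκ.le hr]
  linarith

lemma summable_norm_pow_mul_exp (h : IsNormForm e₁ e₂ A B C) {κ : ℝ} (hκ : 0 < κ) (m : ℕ) :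
    Summable fun p : ℤ × ℤ =>
      ‖(p.1 : ℂ) * e₁ + p.2 * e₂‖ ^ m * Real.exp (-(κ * binForm A B C p.1 p.2)) := by
  refine ((h.summable_exp_mul_exp_norm hκ 1 0 0).mul_left (m.factorial : ℝ)).of_nonneg_of_le
    (fun _ => by positivity) fun p => ?_
  have := pow_le_factorial_mul_exp (norm_nonneg ((p.1 : ℂ) * e₁ + p.2 * e₂)) m
  have h2 := mul_le_mul_of_nonneg_right this (Real.exp_pos (-(κ * binForm A B C p.1 p.2))).le
  simp only [zero_add, one_mul, Complex.ofReal_intCast]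
  linarith

lemma tsum_gaussTerm_dual (h : IsNormForm e₁ e₂ A B C) {s : ℂ} (hs : 0 < s.im) (z₁ z₂ : ℂ) :
    ∑' p, gaussTerm (C / (4 * A * C - B ^ 2)) (-B / (4 * A * C - B ^ 2))
        (A / (4 * A * C - B ^ 2)) s z₁ z₂ p =
      Complex.I * Real.sqrt (4 * A * C - B ^ 2) / s * ∑' p : ℤ × ℤ,
        Complex.exp (2 * Real.pi * Complex.I *
          (-(binForm (A : ℂ) B C (z₁ - p.1) (z₂ - p.2) / s))) := by
  have hD := h.disc_pos
  have hs0 : s ≠ 0 := by rintro rfl; simp at hs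
  rw [tsum_gaussTerm h.dual.left_pos h.dual.disc_pos hs]
  set D := 4 * A * C - B ^ 2 with hDdef
  have hD0 : (D : ℂ) ≠ 0 := Complex.ofReal_ne_zero.mpr hD.ne'
  have hdd : 4 * (C / D) * (A / D) - (-B / D) ^ 2 = 1 / D := by
    field_simp
    rw [hDdef]; ring
  rw [hdd]
  congr 1
  · rw [Real.sqrt_div zero_le_one, Real.sqrt_one]
    push_cast
    have : (Real.sqrt D : ℂ) ≠ 0 := Complex.ofReal_ne_zero.mpr (Real.sqrt_pos.mpr hD).ne'
    field_simp
    rw [Complex.I_sq]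
  · refine tsum_congr fun p => ?_
    congr 2
    simp only [binForm]
    push_cast
    field_simp

/-- Poisson summation for `(x e₁ + y e₂) ^ m` times a Gaussian. Moving the Poisson formula along a
complex isotropic vector `u` gives an identity of exponential generating functions in which the
quadratic part in `u` is absent; its Taylor coefficients are the assertion. -/
theorem tsum_pow_mul_gaussian (h : IsNormForm e₁ e₂ A B C) (m : ℕ) {s : ℂ} (hs : 0 < s.im)
    (r₁ r₂ : ℝ) :
    ∑' p : ℤ × ℤ, Complex.exp (2 * Real.pi * Complex.I *
          (-(binForm A B C (r₁ + p.1) (r₂ + p.2) : ℝ) / s)) *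
        (((r₁ + p.1 : ℝ) : ℂ) * e₁ + ((r₂ + p.2 : ℝ) : ℂ) * e₂) ^ m =
      -Complex.I / Real.sqrt (4 * A * C - B ^ 2) * s ^ (m + 1) * ∑' p : ℤ × ℤ,
        Complex.exp (2 * Real.pi * Complex.I *
          (s * (binForm C (-B) A (p.1 : ℝ) p.2 / (4 * A * C - B ^ 2) : ℝ) -
            (p.1 * r₁ + p.2 * r₂))) *
        (p.1 * dualLeft e₁ e₂ + p.2 * dualRight e₁ e₂) ^ m := by
  have hD := h.disc_pos
  have hs0 : s ≠ 0 := by rintro rfl; simp at hs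
  have hpi : (Real.pi : ℂ) ≠ 0 := Complex.ofReal_ne_zero.mpr Real.pi_ne_zero
  set D := 4 * A * C - B ^ 2 with hDdef
  have hD0 : (D : ℂ) ≠ 0 := Complex.ofReal_ne_zero.mpr hD.ne'
  set w : ℤ × ℤ → ℂ := fun p => Complex.exp (2 * Real.pi * Complex.I *
    (s * (binForm C (-B) A (p.1 : ℝ) p.2 / D : ℝ) - (p.1 * r₁ + p.2 * r₂))) with hw
  set X : ℤ × ℤ → ℂ := fun p => s * (p.1 * dualLeft e₁ e₂ + p.2 * dualRight e₁ e₂) with hX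
  set w' : ℤ × ℤ → ℂ := fun p => Complex.I * Real.sqrt D / s * Complex.exp (2 * Real.pi *
    Complex.I * (-(binForm A B C (r₁ + p.1) (r₂ + p.2) : ℝ) / s)) with hw'
  set X' : ℤ × ℤ → ℂ := fun p =>
    ((r₁ + p.1 : ℝ) : ℂ) * e₁ + ((r₂ + p.2 : ℝ) : ℂ) * e₂ with hX'
  have hsum : ∀ R : ℝ, Summable fun i => ‖w i‖ * Real.exp (R * ‖X i‖) := fun R => by
    refine (h.dual.summable_exp_mul_exp_norm (mul_pos Real.two_pi_pos hs) (R * ‖s‖) 0 0).congr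
      fun p => ?_
    simp only [zero_add, hw, hX, norm_mul, Complex.ofReal_intCast]
    rw [norm_exp_two_pi_I_mul]
    congr 2
    · simp only [Complex.sub_im, Complex.im_mul_ofReal, Complex.add_im, Complex.intCast_im,
        zero_mul, add_zero, sub_zero, binForm]
      ring
    · ring
  have hsum' : ∀ R : ℝ, Summable fun i => ‖w' i‖ * Real.exp (R * ‖X' i‖) := fun R => by
    refine ((h.summable_exp_mul_exp_norm (κ := 2 * Real.pi * (s.im / Complex.normSq s))
      (mul_pos Real.two_pi_pos (div_pos hs (Complex.normSq_pos.mpr hs0))) R r₁ r₂).mul_left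
      ‖Complex.I * Real.sqrt D / s‖).congr fun p => ?_
    simp only [hw', hX']
    rw [norm_mul _ (Complex.exp _), norm_exp_two_pi_I_mul, ← mul_assoc]
    congr 3
    rw [div_eq_mul_inv _ s, ← Complex.ofReal_neg, Complex.im_ofReal_mul, Complex.inv_im]
    ring
  have key := tsum_mul_pow_eq_of_tsum_mul_exp_eq hsum hsum' (fun t => ?_) m
  · simp only [hw', hX, mul_pow, mul_assoc (Complex.I * Real.sqrt D / s), tsum_mul_left] at key
    have hD1 : (Real.sqrt D : ℂ) ≠ 0 := Complex.ofReal_ne_zero.mpr (Real.sqrt_pos.mpr hD).ne'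
    have key' : s ^ m * ∑' i, w i * (i.1 * dualLeft e₁ e₂ + i.2 * dualRight e₁ e₂) ^ m =
        Complex.I * Real.sqrt D / s * ∑' i : ℤ × ℤ, Complex.exp (2 * Real.pi * Complex.I *
          (-(binForm A B C (r₁ + i.1) (r₂ + i.2) : ℝ) / s)) * X' i ^ m := by
      rw [← key, ← tsum_mul_left]
      exact tsum_congr fun i => by ring
    simp only [hw, hX'] at key'
    set S₁ := ∑' i : ℤ × ℤ, Complex.exp _ * _
    set S₂ := ∑' i : ℤ × ℤ, Complex.exp _ * _
    have hI := Complex.I_ne_zero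
    have : S₁ = s / (Complex.I * Real.sqrt D) * (s ^ m * S₂) := by
      rw [key']
      field_simp
    rw [this, pow_succ]
    field_simp
    rw [Complex.I_sq]
    ring
  · have hcov := h.covol_ne_zero
    -- the shift vector is isotropic: the first linear factor of the form vanishes on it
    have hu₀ : dualLeft e₁ e₂ * e₁ + dualRight e₁ e₂ * e₂ = 0 := by
      rw [dualLeft, dualRight]; field_simp; ring
    have hu₁ : dualLeft e₁ e₂ * starRingEnd ℂ e₁ + dualRight e₁ e₂ * starRingEnd ℂ e₂ = 1 := by
      rw [dualLeft, dualRight, div_mul_eq_mul_div, div_mul_eq_mul_div, ← add_div,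
        div_eq_one_iff_eq hcov]
      ring
    have hP := h.tsum_gaussTerm_dual hs (t / (2 * Real.pi * Complex.I) * s * dualLeft e₁ e₂ - r₁)
      (t / (2 * Real.pi * Complex.I) * s * dualRight e₁ e₂ - r₂)
    rw [← hDdef, ← tsum_mul_left] at hP
    convert hP using 1
    · refine tsum_congr fun p => ?_
      simp only [hw, hX, gaussTerm]
      rw [← Complex.exp_add]
      congr 1
      rw [show binForm C (-B) A (p.1 : ℝ) p.2 / D =
        binForm (C / D) (-B / D) (A / D) (p.1 : ℝ) p.2 by simp only [binForm]; ring,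
        binForm_ofReal]
      push_cast
      field_simp
      ring
    · refine tsum_congr fun p => ?_
      simp only [hw', hX']
      rw [mul_assoc, ← Complex.exp_add, binForm_ofReal, h.binForm_eq, h.binForm_eq]
      rw [show (t / (2 * Real.pi * Complex.I) * s * dualLeft e₁ e₂ - r₁ - p.1) * e₁ +
          (t / (2 * Real.pi * Complex.I) * s * dualRight e₁ e₂ - r₂ - p.2) * e₂ =
          -((r₁ + p.1) * e₁ + (r₂ + p.2) * e₂) by
          linear_combination (t / (2 * Real.pi * Complex.I) * s) * hu₀,
        show (t / (2 * Real.pi * Complex.I) * s * dualLeft e₁ e₂ - r₁ - p.1) * starRingEnd ℂ e₁ +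
          (t / (2 * Real.pi * Complex.I) * s * dualRight e₁ e₂ - r₂ - p.2) * starRingEnd ℂ e₂ =
          t / (2 * Real.pi * Complex.I) * s -
            ((r₁ + p.1) * starRingEnd ℂ e₁ + (r₂ + p.2) * starRingEnd ℂ e₂) by
          linear_combination (t / (2 * Real.pi * Complex.I) * s) * hu₁]
      congr 2
      push_cast
      field_simp
      ring

end IsNormForm

/-! ### Transformation of planar theta series under `SL₂(ℤ)` -/

/-- The theta series `∑ (x e₁ + y e₂) ^ m q ^ ‖x e₁ + y e₂‖²` of the lattice spanned by `e₁, e₂`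
in the complex plane. -/
def planarTheta (e₁ e₂ : ℂ) (m : ℕ) (τ : ℂ) : ℂ :=
  ∑' p : ℤ × ℤ, Complex.exp (2 * Real.pi * Complex.I *
    (τ * (‖(p.1 : ℂ) * e₁ + p.2 * e₂‖ ^ 2 : ℝ))) * ((p.1 : ℂ) * e₁ + p.2 * e₂) ^ m

/-- Representing `ℤ × ℤ` by residues and quotients modulo `c`. -/
def residuePairEquiv (c : ℕ) [NeZero c] : (Fin c × Fin c) × (ℤ × ℤ) ≃ ℤ × ℤ :=
  ((Equiv.prodComm _ _).trans (Equiv.prodProdProdComm ℤ ℤ (Fin c) (Fin c))).trans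
    ((Int.divModEquiv c).prodCongr (Int.divModEquiv c)).symm

lemma residuePairEquiv_apply (c : ℕ) [NeZero c] (r : Fin c × Fin c) (p : ℤ × ℤ) :
    residuePairEquiv c (r, p) = (p.1 * c + (r.1 : ℕ), p.2 * c + (r.2 : ℕ)) := rfl

lemma exp_two_pi_I_mul_add_int (z : ℂ) (n : ℤ) :
    Complex.exp (2 * Real.pi * Complex.I * (z + n)) = Complex.exp (2 * Real.pi * Complex.I * z) := by
  rw [mul_add, Complex.exp_add, mul_comm _ (n : ℂ), Complex.exp_int_mul_two_pi_mul_I, mul_one]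

namespace IsNormForm

variable {e₁ e₂ : ℂ} {A B C : ℝ}

lemma summable_planarTheta (h : IsNormForm e₁ e₂ A B C) (m : ℕ) {τ : ℂ} (hτ : 0 < τ.im) :
    Summable fun p : ℤ × ℤ => ‖Complex.exp (2 * Real.pi * Complex.I *
      (τ * (‖(p.1 : ℂ) * e₁ + p.2 * e₂‖ ^ 2 : ℝ))) * ((p.1 : ℂ) * e₁ + p.2 * e₂) ^ m‖ := by
  refine (h.summable_norm_pow_mul_exp (mul_pos Real.two_pi_pos hτ) m).congr fun p => ?_
  have := h.sq_norm p.1 p.2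
  rw [Complex.ofReal_intCast, Complex.ofReal_intCast] at this
  rw [norm_mul, norm_pow, norm_exp_two_pi_I_mul, Complex.im_mul_ofReal, this, mul_comm]
  congr 2
  ring

lemma planarTheta_eq (h : IsNormForm e₁ e₂ A B C) (m : ℕ) (τ : ℂ) : planarTheta e₁ e₂ m τ =
    ∑' p : ℤ × ℤ, Complex.exp (2 * Real.pi * Complex.I *
      (τ * (binForm A B C (p.1 : ℝ) p.2 : ℝ))) * ((p.1 : ℂ) * e₁ + p.2 * e₂) ^ m := by
  refine tsum_congr fun p => ?_
  rw [← h.sq_norm, Complex.ofReal_intCast, Complex.ofReal_intCast]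

/-- The inversion formula relates the theta series of a lattice and of its dual. -/
theorem planarTheta_neg_inv (h : IsNormForm e₁ e₂ A B C) (m : ℕ) {τ : ℂ} (hτ : 0 < τ.im) :
    planarTheta e₁ e₂ m (-1 / τ) = -Complex.I / Real.sqrt (4 * A * C - B ^ 2) * τ ^ (m + 1) *
      planarTheta (dualLeft e₁ e₂) (dualRight e₁ e₂) m τ := by
  rw [h.planarTheta_eq, h.dual.planarTheta_eq]
  convert h.tsum_pow_mul_gaussian m hτ 0 0 using 1
  · refine tsum_congr fun p => ?_
    simp only [zero_add, Complex.ofReal_intCast]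
    congr 3
    ring
  · congr 1
    refine tsum_congr fun p => ?_
    congr 3
    simp only [binForm]
    push_cast
    ring

/-- The term of `cuspSum` at the residue class `r`. -/
def _root_.LatticeTheta.cuspTerm (A B C : ℝ) (a d : ℤ) (c : ℕ) (ν : ℤ × ℤ) (r : Fin c × Fin c) :
    ℂ :=
  Complex.exp (2 * Real.pi * Complex.I *
    ((a * (binForm A B C (r.1 : ℕ) (r.2 : ℕ) : ℝ) - (ν.1 * (r.1 : ℕ) + ν.2 * (r.2 : ℕ)) +
      d * (binForm C (-B) A (ν.1 : ℝ) ν.2 / (4 * A * C - B ^ 2) : ℝ)) / c))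

/-- The exponential sum over residues modulo `c` that appears in the expansion of a theta series at
the cusp `a / c`. -/
def _root_.LatticeTheta.cuspSum (A B C : ℝ) (a d : ℤ) (c : ℕ) (ν : ℤ × ℤ) : ℂ :=
  ∑ r : Fin c × Fin c, cuspTerm A B C a d c ν r

lemma _root_.LatticeTheta.norm_cuspTerm (A B C : ℝ) (a d : ℤ) (c : ℕ) (ν : ℤ × ℤ)
    (r : Fin c × Fin c) : ‖cuspTerm A B C a d c ν r‖ = 1 := by
  rw [cuspTerm, norm_exp_two_pi_I_mul, Real.exp_eq_one_iff, neg_eq_zero]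
  have : ((a * (binForm A B C (r.1 : ℕ) (r.2 : ℕ) : ℝ) - (ν.1 * (r.1 : ℕ) + ν.2 * (r.2 : ℕ)) +
    d * (binForm C (-B) A (ν.1 : ℝ) ν.2 / (4 * A * C - B ^ 2) : ℝ)) / c : ℂ) =
    (((a * binForm A B C (r.1 : ℕ) (r.2 : ℕ) - (ν.1 * (r.1 : ℕ) + ν.2 * (r.2 : ℕ)) +
    d * (binForm C (-B) A (ν.1 : ℝ) ν.2 / (4 * A * C - B ^ 2))) / c : ℝ) : ℂ) := by
    push_cast; rfl
  rw [this, Complex.ofReal_im, mul_zero]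

lemma _root_.LatticeTheta.norm_cuspSum_le (A B C : ℝ) (a d : ℤ) (c : ℕ) (ν : ℤ × ℤ) :
    ‖cuspSum A B C a d c ν‖ ≤ (c : ℝ) ^ 2 := by
  refine (norm_sum_le _ _).trans (le_of_eq ?_)
  rw [Finset.sum_congr rfl fun r _ => norm_cuspTerm A B C a d c ν r]
  simp [sq]

set_option maxHeartbeats 1000000 in
/-- The expansion of a theta series at an arbitrary cusp: split the lattice into residue classes
modulo `c` and apply Poisson summation to each class. -/
theorem planarTheta_smul {A B C : ℤ} (h : IsNormForm e₁ e₂ A B C) (m : ℕ) {τ : ℂ} (hτ : 0 < τ.im)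
    (a b d : ℤ) (c : ℕ) [NeZero c] (hdet : a * d - b * c = 1) :
    planarTheta e₁ e₂ m ((a * τ + b) / (c * τ + d)) =
      -Complex.I / Real.sqrt (4 * A * C - B ^ 2 : ℝ) / c * (c * τ + d) ^ (m + 1) *
        ∑' ν : ℤ × ℤ, Complex.exp (2 * Real.pi * Complex.I *
            (τ * (binForm (C : ℝ) (-B) A (ν.1 : ℝ) ν.2 / (4 * A * C - B ^ 2) : ℝ))) *
          (ν.1 * dualLeft e₁ e₂ + ν.2 * dualRight e₁ e₂) ^ m * cuspSum A B C a d c ν := by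
  have hc0 : (c : ℂ) ≠ 0 := Nat.cast_ne_zero.mpr (NeZero.ne c)
  have hcpos : (0 : ℝ) < c := Nat.cast_pos.mpr (Nat.pos_of_ne_zero (NeZero.ne c))
  set w : ℂ := c * τ + d with hw
  have hwim : w.im = c * τ.im := by simp [hw]
  have hw0 : w ≠ 0 := by
    intro h0
    rw [h0, Complex.zero_im] at hwim
    exact (mul_pos hcpos hτ).ne hwim
  have hsim : 0 < (w / c).im := by
    rw [Complex.div_natCast_im, hwim]; positivity
  have hdetC : (a : ℂ) * d - b * c = 1 := by exact_mod_cast hdet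
  have hsplit : (a * τ + b) / w = a / c - 1 / (c * w) := by
    field_simp
    rw [hw]
    linear_combination (-1 : ℂ) * hdetC
  have him : 0 < ((a * τ + b) / w).im := by
    rw [hsplit, Complex.sub_im, show (a / c : ℂ) = ((a / c : ℝ) : ℂ) by push_cast; rfl,
      Complex.ofReal_im, zero_sub, one_div, Complex.inv_im, neg_div, neg_neg]
    have hn := Complex.normSq_pos.mpr (mul_ne_zero hc0 hw0)
    refine div_pos ?_ hn
    rw [← Complex.ofReal_natCast, Complex.im_ofReal_mul, hwim]
    positivity
  set f : ℤ × ℤ → ℂ := fun p => Complex.exp (2 * Real.pi * Complex.I * ((a * τ + b) / w *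
    (‖(p.1 : ℂ) * e₁ + p.2 * e₂‖ ^ 2 : ℝ))) * ((p.1 : ℂ) * e₁ + p.2 * e₂) ^ m with hf
  have hsum : Summable f := (h.summable_planarTheta m him).of_norm
  have hsum' : Summable fun x => f (residuePairEquiv c x) :=
    (residuePairEquiv c).summable_iff.mpr hsum
  change ∑' p, f p = _
  rw [← (residuePairEquiv c).tsum_eq, hsum'.tsum_prod, tsum_fintype]
  have hclass : ∀ r : Fin c × Fin c, ∑' p : ℤ × ℤ,
      f (residuePairEquiv c (r, p)) =
      -Complex.I / Real.sqrt (4 * A * C - B ^ 2 : ℝ) / c * w ^ (m + 1) *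
      ∑' ν : ℤ × ℤ, Complex.exp (2 * Real.pi * Complex.I *
            (τ * (binForm (C : ℝ) (-B) A (ν.1 : ℝ) ν.2 / (4 * A * C - B ^ 2) : ℝ))) *
          (ν.1 * dualLeft e₁ e₂ + ν.2 * dualRight e₁ e₂) ^ m *
          cuspTerm A B C a d c ν r := by
    intro r
    have hP := h.tsum_pow_mul_gaussian m hsim ((r.1 : ℕ) / c) ((r.2 : ℕ) / c)
    have hL : ∀ p : ℤ × ℤ, f (residuePairEquiv c (r, p)) =
        Complex.exp (2 * Real.pi * Complex.I *
          (a * (binForm (A : ℝ) B C (r.1 : ℕ) (r.2 : ℕ) : ℝ) / c)) * c ^ m *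
        (Complex.exp (2 * Real.pi * Complex.I *
          (-(binForm (A : ℝ) B C ((r.1 : ℕ) / c + p.1) ((r.2 : ℕ) / c + p.2) : ℝ) / (w / c))) *
        ((((r.1 : ℕ) / c + p.1 : ℝ) : ℂ) * e₁ + (((r.2 : ℕ) / c + p.2 : ℝ) : ℂ) * e₂) ^ m) := by
      intro p
      have hn := h.sq_norm (p.1 * c + (r.1 : ℕ)) (p.2 * c + (r.2 : ℕ))
      simp only [hf, residuePairEquiv_apply]
      push_cast at hn ⊢
      rw [← Complex.ofReal_pow, hn]
      set Q := binForm (A : ℝ) B C (p.1 * c + (r.1 : ℕ)) (p.2 * c + (r.2 : ℕ)) with hQ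
      set k : ℤ := A * (p.1 ^ 2 * c + 2 * p.1 * (r.1 : ℕ)) +
        B * (p.1 * p.2 * c + p.1 * (r.2 : ℕ) + p.2 * (r.1 : ℕ)) +
        C * (p.2 ^ 2 * c + 2 * p.2 * (r.2 : ℕ)) with hk
      have hQ1 : (Q : ℂ) = (binForm (A : ℝ) B C (r.1 : ℕ) (r.2 : ℕ) : ℝ) + c * (k : ℂ) := by
        rw [hQ, hk]; simp only [binForm]; push_cast; ring
      have hQ2 : (Q : ℂ) = c ^ 2 *
          (binForm (A : ℝ) B C ((r.1 : ℕ) / c + p.1) ((r.2 : ℕ) / c + p.2) : ℝ) := by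
        rw [hQ]; simp only [binForm]; push_cast; field_simp; ring
      have harg : (a * τ + b) / w * Q =
          (a * (binForm (A : ℝ) B C (r.1 : ℕ) (r.2 : ℕ) : ℝ) / c +
          -(binForm (A : ℝ) B C ((r.1 : ℕ) / c + p.1) ((r.2 : ℕ) / c + p.2) : ℝ) / (w / c)) +
            ((a * k : ℤ) : ℂ) := by
        rw [hsplit, sub_mul]
        nth_rewrite 1 [hQ1]
        rw [hQ2]
        push_cast
        field_simp
        ring
      rw [harg, exp_two_pi_I_mul_add_int, mul_add, Complex.exp_add, mul_mul_mul_comm, ← mul_pow]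
      congr 2
      field_simp
      ring
    rw [tsum_congr hL, tsum_mul_left, hP, ← mul_assoc, ← tsum_mul_left, ← tsum_mul_left]
    refine tsum_congr fun ν => ?_
    have hs : w / c = τ + d / c := by rw [hw]; field_simp
    have hE : Complex.exp (2 * Real.pi * Complex.I *
          (a * (binForm (A : ℝ) B C (r.1 : ℕ) (r.2 : ℕ) : ℝ) / c)) *
        Complex.exp (2 * Real.pi * Complex.I *
          (w / c * (binForm (C : ℝ) (-B) A (ν.1 : ℝ) ν.2 / (4 * A * C - B ^ 2) : ℝ) -
            (ν.1 * (((r.1 : ℕ) / c : ℝ) : ℂ) + ν.2 * (((r.2 : ℕ) / c : ℝ) : ℂ)))) =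
        Complex.exp (2 * Real.pi * Complex.I *
            (τ * (binForm (C : ℝ) (-B) A (ν.1 : ℝ) ν.2 / (4 * A * C - B ^ 2) : ℝ))) *
          cuspTerm A B C a d c ν r := by
      rw [cuspTerm, ← Complex.exp_add, ← Complex.exp_add, hs]
      congr 1
      push_cast
      field_simp
      ring
    have hpow : (c : ℂ) ^ m * (w / c) ^ (m + 1) = w ^ (m + 1) / c := by
      rw [div_pow, pow_succ (c : ℂ)]
      field_simp
    linear_combination (c ^ m * (-Complex.I / Real.sqrt (4 * A * C - B ^ 2 : ℝ) *
      (w / c) ^ (m + 1)) * (ν.1 * dualLeft e₁ e₂ + ν.2 * dualRight e₁ e₂) ^ m) * hE +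
      (-Complex.I / Real.sqrt (4 * A * C - B ^ 2 : ℝ)) * Complex.exp (2 * Real.pi * Complex.I *
            (τ * (binForm (C : ℝ) (-B) A (ν.1 : ℝ) ν.2 / (4 * A * C - B ^ 2) : ℝ))) *
          cuspTerm A B C a d c ν r * (ν.1 * dualLeft e₁ e₂ + ν.2 * dualRight e₁ e₂) ^ m * hpow
  rw [Finset.sum_congr rfl fun r _ => hclass r, ← Finset.mul_sum]
  congr 1
  rw [← Summable.tsum_finsetSum]
  · refine tsum_congr fun ν => ?_
    rw [cuspSum, Finset.mul_sum]
  · intro r _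
    refine Summable.of_norm ((h.dual.summable_planarTheta m hτ).congr fun ν => ?_)
    have hn := h.dual.sq_norm ν.1 ν.2
    rw [Complex.ofReal_intCast, Complex.ofReal_intCast] at hn
    rw [norm_mul _ (cuspTerm _ _ _ _ _ _ _ _), norm_cuspTerm, mul_one, hn,
      show binForm (C : ℝ) (-B) A (ν.1 : ℝ) ν.2 / (4 * A * C - B ^ 2) =
        binForm (C / (4 * A * C - B ^ 2) : ℝ) (-B / (4 * A * C - B ^ 2))
          (A / (4 * A * C - B ^ 2)) (ν.1 : ℝ) ν.2 by simp only [binForm]; ring]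

end IsNormForm

/-! ### Gauss sums of binary quadratic forms -/

/-- The Gauss sum of the binary quadratic form `A x² + B x y + C y²` modulo `p`. -/
def binGaussSum (p : ℕ) [NeZero p] (A B C : ZMod p) : ℂ :=
  ∑ x : ZMod p × ZMod p, ZMod.stdAddChar (binForm A B C x.1 x.2)

section Prime

variable {p : ℕ} [Fact p.Prime]

/-- A one-variable quadratic Gauss sum squares to `(-1/p) p`, independently of the coefficient. -/
lemma sq_sum_stdAddChar_mul_sq (hp : p ≠ 2) {u : ZMod p} (hu : u ≠ 0) :
    (∑ x : ZMod p, ZMod.stdAddChar (u * x ^ 2) : ℂ) ^ 2 = (quadraticChar (ZMod p) (-1) : ℤ) * p := by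
  have hF : ringChar (ZMod p) ≠ 2 := by rwa [ZMod.ringChar_zmod_n]
  set χ : MulChar (ZMod p) ℂ := (quadraticChar (ZMod p)).ringHomComp (Int.castRingHom ℂ) with hχ
  have hχ1 : χ ≠ 1 := by
    rw [hχ, MulChar.ringHomComp_ne_one_iff (RingHom.injective_int _)]
    exact quadraticChar_ne_one hF
  have hχ2 : χ.IsQuadratic := (quadraticChar_isQuadratic (ZMod p)).comp _
  have hψ : (ZMod.stdAddChar (N := p)).mulShift u |>.IsPrimitive := by
    refine AddChar.IsPrimitive.of_ne_one ?_
    exact (ZMod.isPrimitive_stdAddChar p) hu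
  have hg := gaussSum_sq hχ1 hχ2 hψ
  have hsum : (∑ x : ZMod p, ZMod.stdAddChar (u * x ^ 2) : ℂ) =
      gaussSum χ ((ZMod.stdAddChar (N := p)).mulShift u) := by
    have h1 : ∀ t : ZMod p, ∑ x : ZMod p with x ^ 2 = t, (ZMod.stdAddChar (u * x ^ 2) : ℂ) =
        (χ t + 1) * ZMod.stdAddChar (u * t) := by
      intro t
      rw [Finset.sum_congr rfl (g := fun _ => (ZMod.stdAddChar (u * t) : ℂ))
        fun x hx => by rw [(Finset.mem_filter.mp hx).2], Finset.sum_const, nsmul_eq_mul]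
      congr 1
      have := quadraticChar_card_sqrts hF t
      rw [hχ, MulChar.ringHomComp_apply, Int.coe_castRingHom]
      have h2 : ((Finset.univ.filter fun x : ZMod p => x ^ 2 = t).card : ℤ) =
        quadraticChar (ZMod p) t + 1 := by
        rw [← this]
        congr 2
        ext; simp
      change _ = ((quadraticChar (ZMod p) t : ℤ) : ℂ) + 1
      exact_mod_cast h2
    have hz : ∑ t : ZMod p, (ZMod.stdAddChar (u * t) : ℂ) = 0 := by
      have := AddChar.sum_eq_zero_of_ne_one ((ZMod.isPrimitive_stdAddChar p) hu)
      simpa [AddChar.mulShift_apply] using this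
    rw [← Finset.sum_fiberwise _ (fun x : ZMod p => x ^ 2), Finset.sum_congr rfl fun t _ => h1 t]
    simp only [add_mul, one_mul, Finset.sum_add_distrib, hz, add_zero, gaussSum,
      AddChar.mulShift_apply]
  rw [hsum, hg, ZMod.card, hχ, MulChar.ringHomComp_apply, Int.coe_castRingHom]

lemma binGaussSum_eq_of_left_ne_zero (hp : p ≠ 2) {A : ZMod p} (hA : A ≠ 0) (B C : ZMod p) :
    binGaussSum p A B C = (∑ x : ZMod p, ZMod.stdAddChar (A * x ^ 2)) *
      ∑ y : ZMod p, ZMod.stdAddChar ((4 * A)⁻¹ * (4 * A * C - B ^ 2) * y ^ 2) := by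
  have h2 : (2 : ZMod p) ≠ 0 := 
    Ring.two_ne_zero (by rwa [ZMod.ringChar_zmod_n])
  rw [Finset.sum_mul_sum, Finset.sum_comm, binGaussSum, Fintype.sum_prod_type, Finset.sum_comm]
  refine Finset.sum_congr rfl fun y _ => ?_
  -- complete the square in `x`
  refine Fintype.sum_equiv (Equiv.addRight (B * y * (2 * A)⁻¹)) _ _ fun x => ?_
  rw [← AddChar.map_add_eq_mul]
  congr 1
  simp only [binForm, Equiv.coe_addRight]
  have h4 : (4 : ZMod p) ≠ 0 := by
    rw [show (4 : ZMod p) = 2 * 2 by norm_num]; exact mul_ne_zero h2 h2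
  field_simp
  ring

lemma binGaussSum_swap (A B C : ZMod p) : binGaussSum p A B C = binGaussSum p C B A := by
  refine Fintype.sum_equiv (Equiv.prodComm _ _) _ _ fun x => ?_
  congr 1
  simp only [binForm, Equiv.prodComm_apply, Prod.fst_swap, Prod.snd_swap]
  ring

lemma sq_binGaussSum_of_left_ne_zero (hp : p ≠ 2) {A B C : ZMod p} (hA : A ≠ 0)
    (hD : 4 * A * C - B ^ 2 ≠ 0) : binGaussSum p A B C ^ 2 = (p : ℂ) ^ 2 := by
  have h4 : (4 : ZMod p) ≠ 0 := by
    have h2 : (2 : ZMod p) ≠ 0 := Ring.two_ne_zero (by rwa [ZMod.ringChar_zmod_n])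
    rw [show (4 : ZMod p) = 2 * 2 by norm_num]; exact mul_ne_zero h2 h2
  rw [binGaussSum_eq_of_left_ne_zero hp hA, mul_pow, sq_sum_stdAddChar_mul_sq hp hA,
    sq_sum_stdAddChar_mul_sq hp (mul_ne_zero (inv_ne_zero (mul_ne_zero h4 hA)) hD)]
  have := quadraticChar_sq_one (F := ZMod p) (a := -1) (neg_ne_zero.mpr one_ne_zero)
  have h' : ((quadraticChar (ZMod p) (-1) : ℤ) : ℂ) ^ 2 = 1 := by exact_mod_cast this
  linear_combination (p : ℂ) ^ 2 * h'

/-- The Gauss sum of a binary quadratic form that is nondegenerate modulo an odd prime `p` is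
`± p`. -/
theorem sq_binGaussSum (hp : p ≠ 2) {A B C : ZMod p} (hD : 4 * A * C - B ^ 2 ≠ 0) :
    binGaussSum p A B C ^ 2 = (p : ℂ) ^ 2 := by
  by_cases hA : A = 0
  · by_cases hC : C = 0
    · subst hA hC
      have hB : B ≠ 0 := by
        rintro rfl
        simp at hD
      -- the hyperbolic plane: only `x = 0` contributes
      have : binGaussSum p 0 B 0 = p := by
        rw [binGaussSum, Fintype.sum_prod_type, Finset.sum_eq_single 0]
        · simp [binForm]
        · intro x _ hx
          have := AddChar.sum_eq_zero_of_ne_one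
            ((ZMod.isPrimitive_stdAddChar p) (mul_ne_zero hB hx))
          simpa [AddChar.mulShift_apply, binForm] using this
        · simp
      rw [this]
    · rw [binGaussSum_swap]
      exact sq_binGaussSum_of_left_ne_zero hp hC (by rwa [mul_right_comm])
  · exact sq_binGaussSum_of_left_ne_zero hp hA hD

end Prime

/-! ### Transformation under `Γ₀(N)` -/

/-- When `c` is divisible by the level, the shift by `c` times a dual vector identifies the
exponential sum at every dual vector with the Gauss sum at zero. The integers `A', B', C'` are the
coefficients of `c` times the dual form `C' x² - B' x y + A' y²`. -/
lemma cuspSum_eq_binGaussSum {A B C A' B' C' a b c : ℤ} {p : ℕ} [NeZero p]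
    (hD : 4 * A * C - B ^ 2 ≠ 0) (hA : (4 * A * C - B ^ 2) * A' = c * A)
    (hB : (4 * A * C - B ^ 2) * B' = c * B) (hC : (4 * A * C - B ^ 2) * C' = c * C)
    (hdet : a * p - b * c = 1) (ν : ℤ × ℤ) :
    cuspSum A B C b (-c) p ν = binGaussSum p (b * A : ℤ) (b * B : ℤ) (b * C : ℤ) := by
  have hp0 : (p : ℂ) ≠ 0 := Nat.cast_ne_zero.mpr (NeZero.ne p)
  set w₁ : ℤ := 2 * C' * ν.1 - B' * ν.2 with hw₁
  set w₂ : ℤ := -B' * ν.1 + 2 * A' * ν.2 with hw₂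
  set Q : ℤ := binForm C' (-B') A' ν.1 ν.2 with hQ
  have h1 : 2 * A * w₁ + B * w₂ = c * ν.1 := by
    apply mul_left_cancel₀ hD
    rw [hw₁, hw₂]
    linear_combination (4 * A * ν.1) * hC - (2 * A * ν.2 + B * ν.1) * hB + 2 * B * ν.2 * hA
  have h2 : B * w₁ + 2 * C * w₂ = c * ν.2 := by
    apply mul_left_cancel₀ hD
    rw [hw₁, hw₂]
    linear_combination (2 * B * ν.1) * hC - (B * ν.2 + 2 * C * ν.1) * hB + 4 * C * ν.2 * hA
  have h3 : binForm A B C w₁ w₂ = c * Q := by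
    have : 2 * binForm A B C w₁ w₂ = 2 * (c * Q) := by
      simp only [binForm, hQ]
      linear_combination w₁ * h1 + w₂ * h2 + c * ν.1 * hw₁ + c * ν.2 * hw₂
    linarith
  have hbc : ((b * c : ℤ) : ZMod p) = -1 := by
    have : b * c = a * p - 1 := by linarith
    rw [this]
    simp
  have hQD : ((binForm (C : ℝ) (-B) A (ν.1 : ℝ) ν.2 / (4 * A * C - B ^ 2) : ℝ) : ℂ) * c = Q := by
    have hD' : (4 * A * C - B ^ 2 : ℂ) ≠ 0 := by exact_mod_cast hD
    have hA' : (4 * A * C - B ^ 2 : ℂ) * A' = c * A := by exact_mod_cast hA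
    have hB' : (4 * A * C - B ^ 2 : ℂ) * B' = c * B := by exact_mod_cast hB
    have hC' : (4 * A * C - B ^ 2 : ℂ) * C' = c * C := by exact_mod_cast hC
    simp only [binForm, hQ]
    push_cast
    rw [div_mul_eq_mul_div, div_eq_iff hD']
    linear_combination (-(ν.1 : ℂ) ^ 2) * hC' + ν.1 * ν.2 * hB' - (ν.2 : ℂ) ^ 2 * hA'
  have hterm : ∀ r : Fin p × Fin p, cuspTerm A B C b (-c) p ν r =
      ZMod.stdAddChar (binForm ((b * A : ℤ) : ZMod p) (b * B : ℤ) (b * C : ℤ)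
        (((r.1 : ℕ) : ZMod p) + w₁) (((r.2 : ℕ) : ZMod p) + w₂)) := by
    intro r
    have hcast : binForm ((b * A : ℤ) : ZMod p) (b * B : ℤ) (b * C : ℤ)
        (((r.1 : ℕ) : ZMod p) + w₁) (((r.2 : ℕ) : ZMod p) + w₂) =
        ((b * binForm A B C (r.1 : ℕ) (r.2 : ℕ) - (ν.1 * (r.1 : ℕ) + ν.2 * (r.2 : ℕ)) - Q : ℤ) :
          ZMod p) := by
      have e1 := congrArg (Int.cast (R := ZMod p)) h1
      have e2 := congrArg (Int.cast (R := ZMod p)) h2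
      have e3 := congrArg (Int.cast (R := ZMod p)) h3
      simp only [binForm] at e3 ⊢
      push_cast at e1 e2 e3 hbc ⊢
      linear_combination ((b : ZMod p) * (r.1 : ℕ)) * e1 + (b : ZMod p) * (r.2 : ℕ) * e2 +
        (b : ZMod p) * e3 + (ν.1 * (r.1 : ℕ) + ν.2 * (r.2 : ℕ) + (Q : ZMod p)) * hbc
    rw [hcast, ZMod.stdAddChar_coe, cuspTerm]
    congr 1
    rw [mul_div_assoc]
    congr 2
    push_cast
    rw [← hQD]
    simp only [binForm]
    push_cast
    ring
  rw [cuspSum, Finset.sum_congr rfl fun r _ => hterm r, binGaussSum]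
  refine Fintype.sum_bijective
    (fun r : Fin p × Fin p => (((r.1 : ℕ) : ZMod p) + w₁, ((r.2 : ℕ) : ZMod p) + w₂)) ?_ _ _
    fun _ => rfl
  have hbij : ∀ w : ZMod p, Function.Bijective fun r : Fin p => ((r : ℕ) : ZMod p) + w := by
    intro w
    refine (Equiv.addRight w).bijective.comp ?_
    rw [Fintype.bijective_iff_injective_and_card]
    refine ⟨fun r s hrs => ?_, by simp [ZMod.card]⟩
    have := (ZMod.natCast_eq_natCast_iff' _ _ _).mp hrs
    rw [Nat.mod_eq_of_lt r.2, Nat.mod_eq_of_lt s.2] at this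
    exact Fin.ext this
  exact (hbij w₁).prodMap (hbij w₂)

lemma linear_denom_ne_zero {a b c d : ℤ} (hdet : a * d - b * c = 1) {τ : ℂ} (hτ : 0 < τ.im) :
    (c * τ + d : ℂ) ≠ 0 := by
  intro h0
  have him := congrArg Complex.im h0
  have hre := congrArg Complex.re h0
  simp at him hre
  rcases him with h | h
  · simp [h] at hre hdet
    simp [hre] at hdet
  · exact hτ.ne' h

namespace IsNormForm

variable {e₁ e₂ : ℂ}

lemma planarTheta_add_intCast {A B C : ℤ} (h : IsNormForm e₁ e₂ A B C) (m : ℕ) (τ : ℂ) (k : ℤ) :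
    planarTheta e₁ e₂ m (τ + k) = planarTheta e₁ e₂ m τ := by
  rw [h.planarTheta_eq, h.planarTheta_eq]
  refine tsum_congr fun p => ?_
  have : (τ + k) * (binForm (A : ℝ) B C (p.1 : ℝ) p.2 : ℝ) =
      τ * (binForm (A : ℝ) B C (p.1 : ℝ) p.2 : ℝ) + ((k * binForm A B C p.1 p.2 : ℤ) : ℂ) := by
    simp only [binForm]; push_cast; ring
  rw [this, exp_two_pi_I_mul_add_int]

/-- The transformation of a theta series under a matrix of `Γ₀(N)` whose lower right entry is a
positive integer `p`: write the matrix `M` as `(M S) S⁻¹` and expand at the cusp `b / p`. -/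
theorem planarTheta_smul_of_dvd {A B C A' B' C' a b c : ℤ} (h : IsNormForm e₁ e₂ A B C) (m : ℕ)
    {p : ℕ} [NeZero p] (hA : (4 * A * C - B ^ 2) * A' = c * A)
    (hB : (4 * A * C - B ^ 2) * B' = c * B) (hC : (4 * A * C - B ^ 2) * C' = c * C)
    (hdet : a * p - b * c = 1) {σ : ℂ} (hσ : 0 < σ.im) :
    planarTheta e₁ e₂ m ((a * σ + b) / (c * σ + p)) =
      binGaussSum p (b * A : ℤ) (b * B : ℤ) (b * C : ℤ) / p * (c * σ + p) ^ (m + 1) *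
        planarTheta e₁ e₂ m σ := by
  have hD : 4 * A * C - B ^ 2 ≠ 0 := by
    have := h.disc_pos
    norm_cast at this
    exact this.ne'
  have hp0 : (p : ℂ) ≠ 0 := Nat.cast_ne_zero.mpr (NeZero.ne p)
  have hσ0 : σ ≠ 0 := by rintro rfl; simp at hσ
  have hw : (c * σ + p : ℂ) ≠ 0 := by
    have := linear_denom_ne_zero (d := p) hdet hσ
    rwa [Int.cast_natCast] at this
  have hτ : 0 < (-1 / σ).im := by
    rw [neg_div, Complex.neg_im, one_div, Complex.inv_im, neg_div, neg_neg]
    have : 0 < Complex.normSq σ := Complex.normSq_pos.mpr hσ0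
    positivity
  have hS := h.planarTheta_neg_inv m hτ
  have hM := h.planarTheta_smul m hτ b (-a) (-c) p (by linarith)
  have hdual : ∀ ν : ℤ × ℤ, Complex.exp (2 * Real.pi * Complex.I *
            (-1 / σ * (binForm (C : ℝ) (-B) A (ν.1 : ℝ) ν.2 / (4 * A * C - B ^ 2) : ℝ))) *
          (ν.1 * dualLeft e₁ e₂ + ν.2 * dualRight e₁ e₂) ^ m * cuspSum A B C b (-c) p ν =
      binGaussSum p (b * A : ℤ) (b * B : ℤ) (b * C : ℤ) * (Complex.exp (2 * Real.pi * Complex.I *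
            (-1 / σ * (binForm (C / (4 * A * C - B ^ 2) : ℝ) (-B / (4 * A * C - B ^ 2))
              (A / (4 * A * C - B ^ 2)) (ν.1 : ℝ) ν.2 : ℝ))) *
          (ν.1 * dualLeft e₁ e₂ + ν.2 * dualRight e₁ e₂) ^ m) := fun ν => by
    rw [cuspSum_eq_binGaussSum hD hA hB hC hdet, mul_comm,
      show binForm (C : ℝ) (-B) A (ν.1 : ℝ) ν.2 / (4 * A * C - B ^ 2) =
        binForm (C / (4 * A * C - B ^ 2) : ℝ) (-B / (4 * A * C - B ^ 2))
          (A / (4 * A * C - B ^ 2)) (ν.1 : ℝ) ν.2 by simp only [binForm]; ring]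
  rw [tsum_congr hdual, tsum_mul_left, ← h.dual.planarTheta_eq] at hM
  rw [show -1 / (-1 / σ) = σ by field_simp] at hS
  have harg : (b * (-1 / σ) + (-a : ℤ)) / (p * (-1 / σ) + (-c : ℤ)) =
      (a * σ + b) / (c * σ + p) := by
    push_cast
    have : (p * (-1 / σ) + -c : ℂ) = -(c * σ + p) / σ := by field_simp; ring
    rw [this, show (b * (-1 / σ) + -a : ℂ) = -(a * σ + b) / σ by field_simp; ring]
    field_simp
  rw [harg] at hM
  rw [hM, hS]
  have hden : (p * (-1 / σ) + (-c : ℤ) : ℂ) = (c * σ + p) * (-1 / σ) := by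
    push_cast; field_simp; ring
  rw [hden, mul_pow]
  ring

/-- Under `Γ₀(N)` with `N` a multiple of the level, a planar theta series transforms with a sign
that depends on the norm form alone, hence is shared by a lattice and its complex conjugate.
Translating `τ` by an integer changes `d` by a multiple of `c`, so by Dirichlet's theorem `d` may be
taken to be an odd prime `p`, for which the sign is a Gauss sum divided by `p`. -/
theorem _root_.LatticeTheta.exists_sign_planarTheta {A B C A' B' C' : ℤ} {N : ℕ}
    (hD : 0 < 4 * A * C - B ^ 2)
    (hA : (4 * A * C - B ^ 2) * A' = N * A) (hB : (4 * A * C - B ^ 2) * B' = N * B)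
    (hC : (4 * A * C - B ^ 2) * C' = N * C) (m : ℕ) {a b c d : ℤ} (hdet : a * d - b * c = 1)
    (hN : (N : ℤ) ∣ c) :
    ∃ ε : ℂ, ε ^ 2 = 1 ∧ ∀ e₁ e₂ : ℂ, IsNormForm e₁ e₂ A B C → ∀ τ : ℂ, 0 < τ.im →
      planarTheta e₁ e₂ m ((a * τ + b) / (c * τ + d)) =
        ε * (c * τ + d) ^ (m + 1) * planarTheta e₁ e₂ m τ := by
  obtain ⟨c', rfl⟩ := hN
  set c : ℤ := N * c' with hc
  by_cases hc0 : c = 0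
  · rw [hc0] at hdet ⊢
    have had : a * d = 1 := by linarith
    have hd2 : (d : ℂ) ^ 2 = 1 := by
      rcases Int.eq_one_or_neg_one_of_mul_eq_one' had with ⟨_, h⟩ | ⟨_, h⟩ <;> simp [h]
    have hda : (a : ℂ) = d := by
      rcases Int.eq_one_or_neg_one_of_mul_eq_one' had with ⟨h', h⟩ | ⟨h', h⟩ <;> simp [h, h']
    refine ⟨(d : ℂ) ^ (m + 1), by rw [← pow_mul, mul_comm, pow_mul, hd2, one_pow], ?_⟩
    intro e₁ e₂ h τ _
    have hd0 : (d : ℂ) ≠ 0 := by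
      intro h0
      simp [h0] at hd2
    have harg : (a * τ + b) / (((0 : ℤ) : ℂ) * τ + d) = τ + ((b * d : ℤ) : ℂ) := by
      rw [Int.cast_zero, zero_mul, zero_add, hda, div_eq_iff hd0]
      push_cast
      linear_combination (-(b : ℂ)) * hd2
    rw [harg, h.planarTheta_add_intCast, Int.cast_zero, zero_mul, zero_add, ← pow_add, ← two_mul,
      pow_mul, hd2, one_pow, one_mul]
  · have hcop : IsCoprime d (c.natAbs : ℤ) := by
      have : IsCoprime d c := ⟨a, -b, by linarith⟩
      rcases Int.natAbs_eq c with h | h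
      · rwa [h] at this
      · rw [h] at this
        exact (IsCoprime.neg_right_iff _ _).mp this
    obtain ⟨p, hp2, hpp, hpd⟩ := Nat.forall_exists_prime_gt_and_zmodEq 2
      (Int.natAbs_ne_zero.mpr hc0) hcop
    have : Fact p.Prime := ⟨hpp⟩
    obtain ⟨k, hk⟩ : c ∣ p - d := Int.natAbs_dvd.mp (Int.ModEq.dvd hpd.symm)
    have hp : (p : ℤ) = d + c * k := by linarith
    have hdet' : a * p - (b + a * k) * c = 1 := by rw [hp]; linarith
    have hA' : (4 * A * C - B ^ 2) * (A' * c') = c * A := by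
      rw [hc]; linear_combination c' * hA
    have hB' : (4 * A * C - B ^ 2) * (B' * c') = c * B := by
      rw [hc]; linear_combination c' * hB
    have hC' : (4 * A * C - B ^ 2) * (C' * c') = c * C := by
      rw [hc]; linear_combination c' * hC
    have hbc : ((b + a * k : ℤ) : ZMod p) * (c : ZMod p) = -1 := by
      have : (b + a * k) * c = a * p - 1 := by linarith
      rw [← Int.cast_mul, this]
      simp
    have hb0 : ((b + a * k : ℤ) : ZMod p) ≠ 0 := by
      intro h0; rw [h0, zero_mul] at hbc; exact neg_ne_zero.mpr one_ne_zero hbc.symm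
    have hcz : (c : ZMod p) ≠ 0 := by
      intro h0; rw [h0, mul_zero] at hbc; exact neg_ne_zero.mpr one_ne_zero hbc.symm
    -- the discriminant divides `c ^ 2`
    have hDc : (4 * A * C - B ^ 2) * (4 * (A' * c') * (C' * c') - (B' * c') ^ 2) = c ^ 2 := by
      apply mul_left_cancel₀ hD.ne'
      linear_combination (4 * (4 * A * C - B ^ 2) * (C' * c')) * hA' + 4 * c * A * hC' -
        ((4 * A * C - B ^ 2) * (B' * c') + c * B) * hB'
    have hDz : ((4 * A * C - B ^ 2 : ℤ) : ZMod p) ≠ 0 := by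
      intro h0
      have := congrArg (Int.cast (R := ZMod p)) hDc
      rw [Int.cast_mul, h0, zero_mul, Int.cast_pow] at this
      exact pow_ne_zero 2 hcz this.symm
    refine ⟨binGaussSum p ((b + a * k) * A : ℤ) ((b + a * k) * B : ℤ) ((b + a * k) * C : ℤ) / p,
      ?_, ?_⟩
    · rw [div_pow, sq_binGaussSum (by omega), div_self (pow_ne_zero 2 (Nat.cast_ne_zero.mpr
        hpp.ne_zero))]
      have : (4 * (((b + a * k) * A : ℤ) : ZMod p) * (((b + a * k) * C : ℤ) : ZMod p) -
          (((b + a * k) * B : ℤ) : ZMod p) ^ 2) =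
          ((b + a * k : ℤ) : ZMod p) ^ 2 * ((4 * A * C - B ^ 2 : ℤ) : ZMod p) := by
        push_cast; ring
      rw [this]
      exact mul_ne_zero (pow_ne_zero 2 hb0) hDz
    · intro e₁ e₂ h τ hτ
      have hσ : 0 < (τ + ((-k : ℤ) : ℂ)).im := by simpa using hτ
      have key := h.planarTheta_smul_of_dvd m hA' hB' hC' hdet' hσ
      rw [h.planarTheta_add_intCast] at key
      have hden : (c * (τ + ((-k : ℤ) : ℂ)) + p : ℂ) = c * τ + d := by
        have : (p : ℂ) = d + c * k := by exact_mod_cast hp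
        rw [this]; push_cast; ring
      rw [hden] at key
      rw [← key]
      congr 2
      push_cast
      ring

end IsNormForm

/-! ### The modular form attached to a pair of conjugate theta series -/

namespace IsNormForm

variable {e₁ e₂ : ℂ}

lemma norm_planarTheta_term {A B C : ℝ} (h : IsNormForm e₁ e₂ A B C) (m : ℕ) (τ : ℂ) (p : ℤ × ℤ) :
    ‖Complex.exp (2 * Real.pi * Complex.I * (τ * (‖(p.1 : ℂ) * e₁ + p.2 * e₂‖ ^ 2 : ℝ))) *
      ((p.1 : ℂ) * e₁ + p.2 * e₂) ^ m‖ =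
    ‖(p.1 : ℂ) * e₁ + p.2 * e₂‖ ^ m *
      Real.exp (-(2 * Real.pi * τ.im * binForm A B C p.1 p.2)) := by
  have := h.sq_norm p.1 p.2
  rw [Complex.ofReal_intCast, Complex.ofReal_intCast] at this
  rw [norm_mul, norm_pow, norm_exp_two_pi_I_mul, Complex.im_mul_ofReal, this, mul_comm,
    ← mul_assoc (2 * Real.pi)]

/-- The terms of a theta series are dominated by those at the height `y`. -/
lemma norm_planarTheta_term_le {A B C : ℝ} (h : IsNormForm e₁ e₂ A B C) (m : ℕ) {τ : ℂ} {y : ℝ}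
    (hy : y ≤ τ.im) (p : ℤ × ℤ) :
    ‖Complex.exp (2 * Real.pi * Complex.I * (τ * (‖(p.1 : ℂ) * e₁ + p.2 * e₂‖ ^ 2 : ℝ))) *
      ((p.1 : ℂ) * e₁ + p.2 * e₂) ^ m‖ ≤
    ‖(p.1 : ℂ) * e₁ + p.2 * e₂‖ ^ m *
      Real.exp (-(2 * Real.pi * y * binForm A B C p.1 p.2)) := by
  rw [h.norm_planarTheta_term]
  have hq : 0 ≤ binForm A B C (p.1 : ℝ) p.2 := by rw [← h.sq_norm]; positivity
  gcongr

lemma differentiableOn_planarTheta {A B C : ℝ} (h : IsNormForm e₁ e₂ A B C) (m : ℕ) :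
    DifferentiableOn ℂ (planarTheta e₁ e₂ m) {τ | 0 < τ.im} := by
  intro τ hτ
  have hτ' : 0 < τ.im := hτ
  have hopen : IsOpen {z : ℂ | τ.im / 2 < z.im} := isOpen_lt continuous_const Complex.continuous_im
  have hd := Complex.differentiableOn_tsum_of_summable_norm
    (F := fun (p : ℤ × ℤ) (z : ℂ) => Complex.exp (2 * Real.pi * Complex.I *
      (z * (‖(p.1 : ℂ) * e₁ + p.2 * e₂‖ ^ 2 : ℝ))) * ((p.1 : ℂ) * e₁ + p.2 * e₂) ^ m)
    (h.summable_norm_pow_mul_exp (κ := 2 * Real.pi * (τ.im / 2)) (by positivity) m)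
    (fun p => by fun_prop) hopen (fun p z hz => h.norm_planarTheta_term_le m (le_of_lt hz) p)
  exact (hd.differentiableAt (hopen.mem_nhds (half_lt_self hτ'))).differentiableWithinAt

lemma norm_planarTheta_le {A B C : ℝ} (h : IsNormForm e₁ e₂ A B C) (m : ℕ) {τ : ℂ}
    (hτ : 1 ≤ τ.im) : ‖planarTheta e₁ e₂ m τ‖ ≤ ∑' p : ℤ × ℤ,
      ‖(p.1 : ℂ) * e₁ + p.2 * e₂‖ ^ m * Real.exp (-(2 * Real.pi * 1 * binForm A B C p.1 p.2)) :=
  tsum_of_norm_bounded (h.summable_norm_pow_mul_exp (by positivity) m).hasSum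
    fun p => h.norm_planarTheta_term_le m hτ p

lemma exists_norm_planarTheta_smul_le_of_pos {A B C : ℤ} (h : IsNormForm e₁ e₂ A B C) (m : ℕ)
    {a b c d : ℤ} (hdet : a * d - b * c = 1) (hc : 0 < c) :
    ∃ K : ℝ, ∀ τ : ℂ, 1 ≤ τ.im → ‖planarTheta e₁ e₂ m ((a * τ + b) / (c * τ + d))‖ ≤
      K * ‖(c * τ + d : ℂ)‖ ^ (m + 1) := by
  obtain ⟨n, rfl⟩ := Int.eq_ofNat_of_zero_le hc.le
  have hn : NeZero n := ⟨by rintro rfl; simp at hc⟩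
  have hs := h.dual.summable_norm_pow_mul_exp (κ := 2 * Real.pi * 1) (by positivity) m
  refine ⟨‖-Complex.I / Real.sqrt (4 * A * C - B ^ 2 : ℝ) / n‖ * ∑' ν : ℤ × ℤ,
    ‖ν.1 * dualLeft e₁ e₂ + ν.2 * dualRight e₁ e₂‖ ^ m * Real.exp (-(2 * Real.pi * 1 *
      binForm (C / (4 * A * C - B ^ 2) : ℝ) (-B / (4 * A * C - B ^ 2)) (A / (4 * A * C - B ^ 2))
        ν.1 ν.2)) * (n : ℝ) ^ 2, fun τ hτ => ?_⟩
  rw [Int.cast_natCast, h.planarTheta_smul m (by linarith) a b d n hdet, norm_mul, norm_mul,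
    norm_pow, mul_right_comm]
  refine mul_le_mul_of_nonneg_right (mul_le_mul_of_nonneg_left ?_ (norm_nonneg _)) (by positivity)
  refine tsum_of_norm_bounded (hs.mul_right _).hasSum fun ν => ?_
  rw [norm_mul _ (cuspSum _ _ _ _ _ _ _)]
  refine mul_le_mul ?_ (norm_cuspSum_le _ _ _ _ _ _ _) (norm_nonneg _) (by positivity)
  have hle := h.dual.norm_planarTheta_term_le m hτ ν
  have hn := h.dual.sq_norm ν.1 ν.2
  rw [Complex.ofReal_intCast, Complex.ofReal_intCast] at hn
  rw [hn] at hle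
  rwa [show binForm (C : ℝ) (-B) A (ν.1 : ℝ) ν.2 / (4 * A * C - B ^ 2) =
    binForm (C / (4 * A * C - B ^ 2) : ℝ) (-B / (4 * A * C - B ^ 2))
      (A / (4 * A * C - B ^ 2)) (ν.1 : ℝ) ν.2 by simp only [binForm]; ring]

/-- Theta series are bounded at every cusp. -/
lemma exists_norm_planarTheta_smul_le {A B C : ℤ} (h : IsNormForm e₁ e₂ A B C) (m : ℕ)
    {a b c d : ℤ} (hdet : a * d - b * c = 1) :
    ∃ K : ℝ, ∀ τ : ℂ, 1 ≤ τ.im → ‖planarTheta e₁ e₂ m ((a * τ + b) / (c * τ + d))‖ ≤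
      K * ‖(c * τ + d : ℂ)‖ ^ (m + 1) := by
  rcases lt_trichotomy c 0 with hc | hc | hc
  · obtain ⟨K, hK⟩ := h.exists_norm_planarTheta_smul_le_of_pos m (a := -a) (b := -b) (c := -c)
      (d := -d) (by linarith) (by linarith)
    refine ⟨K, fun τ hτ => ?_⟩
    have := hK τ hτ
    push_cast at this
    rwa [show (-c * τ + -d : ℂ) = -(c * τ + d) by ring, norm_neg,
      show (-a * τ + -b : ℂ) = -(a * τ + b) by ring, neg_div_neg_eq] at this
  · subst hc
    -- up to sign the matrix is a translation; the discriminant serves as a multiple of the level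
    obtain ⟨ε, hε, hT⟩ := exists_sign_planarTheta (N := 4 * A * C - B ^ 2 |>.toNat)
      (A' := A) (B' := B) (C' := C) (by exact_mod_cast h.disc_pos)
      (by rw [Int.toNat_of_nonneg (by exact_mod_cast h.disc_pos.le)])
      (by rw [Int.toNat_of_nonneg (by exact_mod_cast h.disc_pos.le)])
      (by rw [Int.toNat_of_nonneg (by exact_mod_cast h.disc_pos.le)]) m hdet (dvd_zero _)
    refine ⟨∑' p : ℤ × ℤ, ‖(p.1 : ℂ) * e₁ + p.2 * e₂‖ ^ m *
      Real.exp (-(2 * Real.pi * 1 * binForm (A : ℝ) B C p.1 p.2)), fun τ hτ => ?_⟩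
    have hε1 : ‖ε‖ = 1 := by
      have := congrArg norm hε
      rw [norm_pow, norm_one] at this
      exact (pow_eq_one_iff_of_nonneg (norm_nonneg _) two_ne_zero).mp this
    rw [hT e₁ e₂ h τ (by linarith), norm_mul, norm_mul, hε1, one_mul, norm_pow, mul_comm]
    exact mul_le_mul_of_nonneg_right (h.norm_planarTheta_le m hτ) (by positivity)
  · exact h.exists_norm_planarTheta_smul_le_of_pos m hdet hc

/-- The product of the theta series of a lattice and of its complex conjugate, weighted by `m`-th
powers, is a modular form of weight `2m + 2` for `Γ₀(N)`: the signs of the two factors cancel. -/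
theorem exists_modularForm {A B C A' B' C' : ℤ} {N : ℕ} [NeZero N] (h : IsNormForm e₁ e₂ A B C)
    (hA : (4 * A * C - B ^ 2) * A' = N * A) (hB : (4 * A * C - B ^ 2) * B' = N * B)
    (hC : (4 * A * C - B ^ 2) * C' = N * C) (m : ℕ) :
    ∃ f : ModularForm (CongruenceSubgroup.Gamma0 N) (2 * (m : ℤ) + 2), ∀ τ : UpperHalfPlane,
      f τ = planarTheta e₁ e₂ m τ *
        planarTheta (starRingEnd ℂ e₁) (starRingEnd ℂ e₂) m τ := by
  set F : UpperHalfPlane → ℂ := fun τ => planarTheta e₁ e₂ m τ *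
        planarTheta (starRingEnd ℂ e₁) (starRingEnd ℂ e₂) m τ with hF
  have hdet : ∀ γ : SL(2, ℤ), γ 0 0 * γ 1 1 - γ 0 1 * γ 1 0 = 1 := fun γ => by
    rw [← Matrix.det_fin_two]; exact γ.det_coe
  have hcoe : ∀ (γ : SL(2, ℤ)) (τ : UpperHalfPlane), ((γ • τ : UpperHalfPlane) : ℂ) =
      (γ 0 0 * (τ : ℂ) + γ 0 1) / (γ 1 0 * (τ : ℂ) + γ 1 1) := fun γ τ => by
    rw [UpperHalfPlane.coe_specialLinearGroup_apply]
    simp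
  refine ⟨⟨⟨F, ?_⟩, ?_, ?_⟩, fun τ => rfl⟩
  · intro γ hγ
    obtain ⟨g, hg, rfl⟩ := hγ
    change F ∣[2 * (m : ℤ) + 2] g = F
    funext τ
    rw [ModularForm.slash_action_eq'_iff]
    have hNg : (N : ℤ) ∣ g 1 0 :=
      (ZMod.intCast_zmod_eq_zero_iff_dvd _ _).mp (CongruenceSubgroup.Gamma0_mem.mp hg)
    obtain ⟨ε, hε, hT⟩ := exists_sign_planarTheta (by exact_mod_cast h.disc_pos) hA hB hC m
      (hdet g) hNg
    simp only [hF]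
    rw [hcoe, hT _ _ h τ τ.im_pos, hT _ _ h.conj τ τ.im_pos,
      show (2 * (m : ℤ) + 2) = ((2 * (m + 1) : ℕ) : ℤ) by push_cast; ring, zpow_natCast,
      two_mul, pow_add]
    linear_combination ((g 1 0 * (τ : ℂ) + g 1 1) ^ (m + 1)) ^ 2 * planarTheta e₁ e₂ m τ *
        planarTheta (starRingEnd ℂ e₁) (starRingEnd ℂ e₂) m τ * hε
  · rw [UpperHalfPlane.mdifferentiable_iff]
    refine ((h.differentiableOn_planarTheta m).mul
      (h.conj.differentiableOn_planarTheta m)).congr fun z hz => ?_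
    simp [hF, UpperHalfPlane.ofComplex_apply_of_im_pos hz]
  · intro c hc
    rw [Subgroup.IsArithmetic.isCusp_iff_isCusp_SL2Z] at hc
    rw [OnePoint.isBoundedAt_iff_forall_SL2Z hc]
    intro γ _
    rw [UpperHalfPlane.isBoundedAtImInfty_iff]
    obtain ⟨K₁, hK₁⟩ := h.exists_norm_planarTheta_smul_le m (hdet γ)
    obtain ⟨K₂, hK₂⟩ := h.conj.exists_norm_planarTheta_smul_le m (hdet γ)
    refine ⟨K₁ * K₂, 1, fun τ hτ => ?_⟩
    have hne : (γ 1 0 * (τ : ℂ) + γ 1 1) ≠ 0 := linear_denom_ne_zero (hdet γ) τ.im_pos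
    have h1 := hK₁ τ hτ
    have h2 := hK₂ τ hτ
    have hden : UpperHalfPlane.denom γ τ = γ 1 0 * (τ : ℂ) + γ 1 1 := by
      rw [UpperHalfPlane.denom]; simp
    change ‖(F ∣[2 * (m : ℤ) + 2] γ) τ‖ ≤ _
    rw [ModularForm.SL_slash_apply, hden, norm_mul, hF]
    simp only
    rw [hcoe, norm_mul, norm_zpow, zpow_neg,
      show (2 * (m : ℤ) + 2) = ((2 * (m + 1) : ℕ) : ℤ) by push_cast; ring, zpow_natCast]
    have hpos : 0 < ‖(γ 1 0 * (τ : ℂ) + γ 1 1)‖ ^ (m + 1) := pow_pos (norm_pos_iff.mpr hne) _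
    rw [two_mul, pow_add, ← div_eq_mul_inv, div_le_iff₀ (mul_pos hpos hpos)]
    calc _ ≤ _ := mul_le_mul h1 h2 (norm_nonneg _) ((norm_nonneg _).trans h1)
      _ = _ := by ring

end IsNormForm

/-! ### Harmonic polynomials in the plane -/

/-- The real and imaginary parts of `(X + iY) ^ m` as polynomials in `X, Y`. -/
def powReIm : ℕ → MvPolynomial (Fin 2) ℝ × MvPolynomial (Fin 2) ℝ
  | 0 => (1, 0)
  | m + 1 => (MvPolynomial.X 0 * (powReIm m).1 - MvPolynomial.X 1 * (powReIm m).2,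
      MvPolynomial.X 0 * (powReIm m).2 + MvPolynomial.X 1 * (powReIm m).1)

lemma powReIm_isHomogeneous (m : ℕ) :
    (powReIm m).1.IsHomogeneous m ∧ (powReIm m).2.IsHomogeneous m := by
  induction m with
  | zero => exact ⟨MvPolynomial.isHomogeneous_one _ _, MvPolynomial.isHomogeneous_zero _ _ _⟩
  | succ m ih =>
    have hX := fun i => MvPolynomial.isHomogeneous_X ℝ (σ := Fin 2) i
    rw [powReIm, add_comm m 1]
    exact ⟨((hX 0).mul ih.1).sub ((hX 1).mul ih.2), ((hX 0).mul ih.2).add ((hX 1).mul ih.1)⟩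

lemma pderiv_pderiv_comm {σ R : Type*} [CommRing R] (i j : σ) (P : MvPolynomial σ R) :
    MvPolynomial.pderiv i (MvPolynomial.pderiv j P) =
      MvPolynomial.pderiv j (MvPolynomial.pderiv i P) := by
  classical
  have : ⁅MvPolynomial.pderiv (R := R) i, MvPolynomial.pderiv (R := R) j⁆ = 0 := by
    refine MvPolynomial.derivation_ext fun k => ?_
    rw [Derivation.commutator_apply, MvPolynomial.pderiv_X, MvPolynomial.pderiv_X,
      Pi.single_apply, Pi.single_apply]
    split_ifs <;> simp
  rw [← sub_eq_zero, ← Derivation.commutator_apply, this, Derivation.zero_apply]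

/-- The Cauchy–Riemann equations. -/
lemma powReIm_cauchyRiemann (m : ℕ) :
    MvPolynomial.pderiv 0 (powReIm m).1 = MvPolynomial.pderiv 1 (powReIm m).2 ∧
      MvPolynomial.pderiv 1 (powReIm m).1 = -MvPolynomial.pderiv 0 (powReIm m).2 := by
  induction m with
  | zero => simp [powReIm]
  | succ m ih =>
    have h01 : MvPolynomial.pderiv (R := ℝ) (0 : Fin 2) (MvPolynomial.X 1) = 0 :=
      MvPolynomial.pderiv_X_of_ne (by decide)
    have h10 : MvPolynomial.pderiv (R := ℝ) (1 : Fin 2) (MvPolynomial.X 0) = 0 :=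
      MvPolynomial.pderiv_X_of_ne (by decide)
    constructor
    · simp only [powReIm, map_sub, map_add, MvPolynomial.pderiv_mul, MvPolynomial.pderiv_X_self,
        h01, h10]
      linear_combination MvPolynomial.X 0 * ih.1 - MvPolynomial.X 1 * ih.2
    · simp only [powReIm, map_sub, map_add, MvPolynomial.pderiv_mul, MvPolynomial.pderiv_X_self,
        h01, h10]
      linear_combination MvPolynomial.X 0 * ih.2 + MvPolynomial.X 1 * ih.1

/-- A vector of the Euclidean plane as a complex number. -/
def toComplex (v : E2) : ℂ := (v 0 : ℂ) + Complex.I * (v 1 : ℂ)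

lemma eval_powReIm (m : ℕ) (v : E2) :
    toComplex v ^ m = (MvPolynomial.eval (fun i => v i) (powReIm m).1 : ℂ) +
      Complex.I * (MvPolynomial.eval (fun i => v i) (powReIm m).2 : ℂ) := by
  induction m with
  | zero => simp [powReIm]
  | succ m ih =>
    rw [pow_succ, ih, toComplex]
    simp only [powReIm, map_sub, map_add, map_mul, MvPolynomial.eval_X]
    push_cast
    linear_combination ((v 1 : ℂ) * (MvPolynomial.eval (fun i => v i) (powReIm m).2 : ℂ)) *
      Complex.I_sq

lemma isHarmonicHomogeneous_h1 (n : ℕ) : IsHarmonicHomogeneous (2 * n) (h1 n) := by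
  obtain ⟨hx, hy⟩ := powReIm_cauchyRiemann (2 * n)
  refine ⟨(powReIm (2 * n)).1, (powReIm_isHomogeneous _).1, ?_, fun v => ?_⟩
  · rw [hx, hy, map_neg, pderiv_pderiv_comm]
    ring
  · change (toComplex v ^ (2 * n)).re = _
    rw [eval_powReIm]
    simp

lemma isHarmonicHomogeneous_h2 (n : ℕ) : IsHarmonicHomogeneous (2 * n) (h2 n) := by
  obtain ⟨hx, hy⟩ := powReIm_cauchyRiemann (2 * n)
  refine ⟨(powReIm (2 * n)).2, (powReIm_isHomogeneous _).2, ?_, fun v => ?_⟩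
  · rw [← hx, ← neg_eq_iff_eq_neg.mpr hy, map_neg, pderiv_pderiv_comm]
    ring
  · change (toComplex v ^ (2 * n)).im = _
    rw [eval_powReIm]
    simp

/-! ### Pairs of lattice vectors and angles -/

lemma h1_eq (n : ℕ) (v : E2) : h1 n v = (toComplex v ^ (2 * n)).re := rfl

lemma h2_eq (n : ℕ) (v : E2) : h2 n v = (toComplex v ^ (2 * n)).im := rfl

lemma norm_toComplex (v : E2) : ‖toComplex v‖ = ‖v‖ := by
  rw [EuclideanSpace.norm_eq, Complex.norm_def, Complex.normSq_apply, toComplex]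
  simp [Fin.sum_univ_two, sq]

lemma toComplex_add (v w : E2) : toComplex (v + w) = toComplex v + toComplex w := by
  simp [toComplex]; ring

lemma toComplex_smul (r : ℝ) (v : E2) : toComplex (r • v) = r * toComplex v := by
  simp [toComplex]; ring

lemma toComplex_neg (v : E2) : toComplex (-v) = -toComplex v := by
  simp [toComplex]; ring

lemma toComplex_mul_conj_re (v w : E2) :
    (toComplex v * starRingEnd ℂ (toComplex w)).re = ⟪v, w⟫ := by
  simp [toComplex, PiLp.inner_apply, Fin.sum_univ_two]
  ring

/-- The summand of `angleCoeff`. -/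
def angleTerm (n : ℕ) (p : E2 × E2) : ℝ :=
  Real.cos (2 * n * InnerProductGeometry.angle p.1 p.2) * ‖p.1‖ ^ (2 * n) * ‖p.2‖ ^ (2 * n)

/-- The unoriented angle is the absolute value of the argument of the quotient, and the cosine does
not see the sign. -/
lemma angleTerm_eq_re {n : ℕ} (hn : 0 < n) (p : E2 × E2) :
    angleTerm n p = ((toComplex p.1 * starRingEnd ℂ (toComplex p.2)) ^ (2 * n)).re := by
  obtain ⟨v, w⟩ := p
  have h2n : 2 * n ≠ 0 := by omega
  by_cases hv : v = 0
  · subst hv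
    simp [angleTerm, toComplex, h2n]
  by_cases hw : w = 0
  · subst hw
    simp [angleTerm, toComplex, h2n]
  simp only [angleTerm]
  set z := toComplex v * starRingEnd ℂ (toComplex w) with hz
  have hnz : ‖z‖ = ‖v‖ * ‖w‖ := by
    rw [hz, norm_mul, Complex.norm_conj, norm_toComplex, norm_toComplex]
  have hz0 : z ≠ 0 := by
    rw [← norm_pos_iff, hnz]
    exact mul_pos (norm_pos_iff.mpr hv) (norm_pos_iff.mpr hw)
  have hang : InnerProductGeometry.angle v w = |z.arg| := by
    rw [InnerProductGeometry.angle, ← toComplex_mul_conj_re, ← hz, ← hnz,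
      ← Complex.cos_arg hz0, ← Real.cos_abs, Real.arccos_cos (abs_nonneg _) (Complex.abs_arg_le_pi _)]
  rw [hang, ← Real.cos_abs, abs_mul, abs_abs, ← abs_mul, Real.cos_abs]
  have hpow : z ^ (2 * n) = ((‖z‖ ^ (2 * n) : ℝ) : ℂ) *
      Complex.exp (((2 * n * z.arg : ℝ) : ℂ) * Complex.I) := by
    conv_lhs => rw [← Complex.norm_mul_exp_arg_mul_I z]
    rw [mul_pow, ← Complex.exp_nat_mul]
    push_cast
    congr 2
    ring
  rw [hpow, Complex.re_ofReal_mul, Complex.exp_ofReal_mul_I_re, hnz, mul_pow]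
  ring

lemma h1_mul_add_h2_mul {n : ℕ} (hn : 0 < n) (v w : E2) :
    h1 n v * h1 n w + h2 n v * h2 n w = angleTerm n (v, w) := by
  rw [angleTerm_eq_re hn, h1_eq, h1_eq, h2_eq, h2_eq, mul_pow, ← map_pow, Complex.mul_re,
    Complex.conj_re, Complex.conj_im]
  ring

lemma abs_h1_le (n : ℕ) (v : E2) : |h1 n v| ≤ ‖v‖ ^ (2 * n) := by
  rw [h1_eq, ← norm_toComplex, ← norm_pow]
  exact Complex.abs_re_le_norm _

lemma abs_h2_le (n : ℕ) (v : E2) : |h2 n v| ≤ ‖v‖ ^ (2 * n) := by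
  rw [h2_eq, ← norm_toComplex, ← norm_pow]
  exact Complex.abs_im_le_norm _

/-- The exponential factor of `thetaTerm`. -/
def qPow (τ : UpperHalfPlane) (x : ℝ) : ℂ :=
  Complex.exp (2 * Real.pi * Complex.I * (τ : ℂ) * (x : ℂ))

lemma qPow_add (τ : UpperHalfPlane) (x y : ℝ) : qPow τ (x + y) = qPow τ x * qPow τ y := by
  rw [qPow, qPow, qPow, ← Complex.exp_add]
  push_cast
  ring_nf

lemma qPow_natCast (τ : UpperHalfPlane) (m : ℕ) :
    qPow τ m = Complex.exp (2 * Real.pi * Complex.I * (τ : ℂ)) ^ m := by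
  rw [qPow, ← Complex.exp_nat_mul]
  push_cast
  ring_nf

section Lattice

variable {Λ : Submodule ℤ E2} {n : ℕ} {τ : UpperHalfPlane}

lemma summable_norm_thetaTerm {h : E2 → ℝ} (hh : ∀ v, |h v| ≤ ‖v‖ ^ (2 * n))
    (hs : Summable fun γ : Λ => ‖(γ : E2)‖ ^ (2 * n) * ‖qPow τ (‖(γ : E2)‖ ^ 2)‖) :
    Summable fun γ : Λ => ‖thetaTerm h τ (γ : E2)‖ := by
  refine hs.of_nonneg_of_le (fun _ => norm_nonneg _) fun γ => ?_
  rw [thetaTerm, norm_mul, Complex.norm_real, Real.norm_eq_abs]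
  exact mul_le_mul_of_nonneg_right (hh _) (norm_nonneg _)

/-- `Θ_{nn,Λ}` as a sum over pairs of lattice vectors. -/
lemma hasSum_thetaNN (hn : 0 < n)
    (hs : Summable fun γ : Λ => ‖(γ : E2)‖ ^ (2 * n) * ‖qPow τ (‖(γ : E2)‖ ^ 2)‖) :
    HasSum (fun p : Λ × Λ => (angleTerm n (p.1, p.2) : ℂ) *
      qPow τ (‖(p.1 : E2)‖ ^ 2 + ‖(p.2 : E2)‖ ^ 2)) (thetaNN n Λ τ) := by
  have s1 := summable_norm_thetaTerm (abs_h1_le n) hs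
  have s2 := summable_norm_thetaTerm (abs_h2_le n) hs
  have p1 := (summable_mul_of_summable_norm s1 s1).hasSum
  have p2 := (summable_mul_of_summable_norm s2 s2).hasSum
  rw [← tsum_mul_tsum_of_summable_norm s1 s1] at p1
  rw [← tsum_mul_tsum_of_summable_norm s2 s2] at p2
  rw [thetaNN, sq, sq]
  refine (p1.add p2).congr_fun fun p => ?_
  rw [← h1_mul_add_h2_mul hn, qPow_add]
  simp only [thetaTerm, qPow]
  push_cast
  ring

/-- The lattice vectors and their images under an isometry. -/
def rotateEquiv (φ : E2 ≃ₗᵢ[ℝ] E2) (Λ : Submodule ℤ E2) : Λ ≃ rotate φ Λ :=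
  (Submodule.equivMapOfInjective (φ.toLinearEquiv.toLinearMap.restrictScalars ℤ)
    φ.injective Λ).toEquiv

lemma coe_rotateEquiv (φ : E2 ≃ₗᵢ[ℝ] E2) (γ : Λ) : (rotateEquiv φ Λ γ : E2) = φ γ := rfl

lemma thetaNN_rotate (hn : 0 < n)
    (hs : Summable fun γ : Λ => ‖(γ : E2)‖ ^ (2 * n) * ‖qPow τ (‖(γ : E2)‖ ^ 2)‖)
    (φ : E2 ≃ₗᵢ[ℝ] E2) : thetaNN n (rotate φ Λ) τ = thetaNN n Λ τ := by
  have hs' : Summable fun γ : rotate φ Λ =>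
      ‖(γ : E2)‖ ^ (2 * n) * ‖qPow τ (‖(γ : E2)‖ ^ 2)‖ := by
    rw [← (rotateEquiv φ Λ).summable_iff]
    simpa [Function.comp_def, coe_rotateEquiv] using hs
  have h1 := hasSum_thetaNN hn hs'
  rw [← ((rotateEquiv φ Λ).prodCongr (rotateEquiv φ Λ)).hasSum_iff] at h1
  refine h1.unique ?_
  convert hasSum_thetaNN hn hs using 2 with p
  have := φ.toLinearIsometry.angle_map (p.1 : E2) p.2
  simp only [LinearIsometryEquiv.coe_toLinearIsometry] at this
  simp [coe_rotateEquiv, angleTerm, this]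

/-! ### The `q`-expansion and integrality -/

lemma hasSum_angleCoeff (hn : 0 < n) (hint : IsIntegralLattice Λ)
    (hfin : ∀ m, (pairsOfLength Λ m).Finite)
    (hs : Summable fun γ : Λ => ‖(γ : E2)‖ ^ (2 * n) * ‖qPow τ (‖(γ : E2)‖ ^ 2)‖) :
    HasSum (fun m : ℕ => (angleCoeff n Λ m : ℂ) *
      Complex.exp (2 * Real.pi * Complex.I * (τ : ℂ)) ^ m) (thetaNN n Λ τ) := by
  choose N hN using fun γ : Λ => hint γ γ.2
  have h1 := (hasSum_thetaNN hn hs).tsum_fiberwise (fun p => N p.1 + N p.2)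
  refine h1.congr_fun fun m => ?_
  have hlen : ∀ p : Λ × Λ, ‖(p.1 : E2)‖ ^ 2 + ‖(p.2 : E2)‖ ^ 2 = ((N p.1 + N p.2 : ℕ) : ℝ) :=
    fun p => by rw [hN, hN]; push_cast; rfl
  let e : ((fun p : Λ × Λ => N p.1 + N p.2) ⁻¹' {m}) ≃ pairsOfLength Λ m :=
    { toFun := fun p => ⟨(p.1.1, p.1.2), p.1.1.2, p.1.2.2, by
        rw [hlen, show N p.1.1 + N p.1.2 = m from p.2]⟩
      invFun := fun p => ⟨(⟨p.1.1, p.2.1⟩, ⟨p.1.2, p.2.2.1⟩), by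
        have h2 := (hlen (⟨p.1.1, p.2.1⟩, ⟨p.1.2, p.2.2.1⟩)).symm.trans p.2.2.2
        exact Nat.cast_injective h2⟩
      left_inv := fun p => rfl
      right_inv := fun p => rfl }
  have : Finite (pairsOfLength Λ m) := (hfin m).to_subtype
  have hterm : ∀ p : ((fun p : Λ × Λ => N p.1 + N p.2) ⁻¹' {m}),
      (angleTerm n (p.1.1, p.1.2) : ℂ) * qPow τ (‖(p.1.1 : E2)‖ ^ 2 + ‖(p.1.2 : E2)‖ ^ 2) =
        ((angleTerm n (e p) : ℝ) : ℂ) * qPow τ m := fun p => by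
    rw [hlen, show N p.1.1 + N p.1.2 = m from p.2]
    rfl
  rw [tsum_congr hterm, tsum_mul_right, qPow_natCast,
    e.tsum_eq (fun p : pairsOfLength Λ m => ((angleTerm n p : ℝ) : ℂ)), ← Complex.ofReal_tsum,
    tsum_eq_finsum (Set.toFinite _), finsum_set_coe_eq_finsum_mem (pairsOfLength Λ m)]
  rfl

/-- The power sums of a complex number with integral trace and norm are integers. -/
lemma exists_int_pow_add_conj_pow {z : ℂ} {t d : ℤ} (ht : z + starRingEnd ℂ z = t)
    (hd : z * starRingEnd ℂ z = d) (m : ℕ) :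
    ∃ s : ℤ, z ^ m + starRingEnd ℂ z ^ m = s := by
  induction m using Nat.twoStepInduction with
  | zero => exact ⟨2, by norm_num⟩
  | one => exact ⟨t, by simpa using ht⟩
  | more m ih₀ ih₁ =>
    obtain ⟨s₀, h₀⟩ := ih₀
    obtain ⟨s₁, h₁⟩ := ih₁
    refine ⟨t * s₁ - d * s₀, ?_⟩
    push_cast
    rw [← ht, ← hd, ← h₀, ← h₁]
    ring

lemma exists_int_two_mul_angleTerm (hn : 0 < n) (hint : IsIntegralLattice Λ) {v w : E2}
    (hv : v ∈ Λ) (hw : w ∈ Λ) : ∃ z : ℤ, 2 * angleTerm n (v, w) = z := by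
  obtain ⟨a, ha⟩ := hint v hv
  obtain ⟨b, hb⟩ := hint w hw
  obtain ⟨c, hc⟩ := hint (v + w) (Λ.add_mem hv hw)
  set z := toComplex v * starRingEnd ℂ (toComplex w) with hz
  have ht : z + starRingEnd ℂ z = ((c - a - b : ℤ) : ℂ) := by
    rw [Complex.add_conj, hz, toComplex_mul_conj_re]
    have : 2 * ⟪v, w⟫ = (c : ℝ) - a - b := by
      rw [← ha, ← hb, ← hc, norm_add_sq_real]; ring
    rw [this]
    push_cast
    rfl
  have hd : z * starRingEnd ℂ z = ((a * b : ℤ) : ℂ) := by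
    have : ‖z‖ ^ 2 = (a * b : ℝ) := by
      rw [hz, norm_mul, Complex.norm_conj, norm_toComplex, norm_toComplex, mul_pow, ha, hb]
    rw [Complex.mul_conj, Complex.normSq_eq_norm_sq, this]
    push_cast
    rfl
  obtain ⟨s, hs⟩ := exists_int_pow_add_conj_pow ht hd (2 * n)
  refine ⟨s, ?_⟩
  rw [angleTerm_eq_re hn, ← hz]
  rw [← map_pow, Complex.add_conj] at hs
  exact_mod_cast hs

lemma angleTerm_self (hn : 0 < n) (v : E2) : angleTerm n (v, v) = (‖v‖ ^ 2) ^ (2 * n) := by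
  rw [angleTerm_eq_re hn, Complex.mul_conj, Complex.normSq_eq_norm_sq, norm_toComplex,
    ← Complex.ofReal_pow, Complex.ofReal_re]

lemma angleTerm_swap (v w : E2) : angleTerm n (v, w) = angleTerm n (w, v) := by
  rw [angleTerm, angleTerm, InnerProductGeometry.angle_comm]
  ring

lemma angleTerm_neg_left (hn : 0 < n) (v w : E2) : angleTerm n (-v, w) = angleTerm n (v, w) := by
  rw [angleTerm_eq_re hn, angleTerm_eq_re hn, toComplex_neg, neg_mul, (even_two_mul n).neg_pow]

lemma angleTerm_neg_right (hn : 0 < n) (v w : E2) : angleTerm n (v, -w) = angleTerm n (v, w) := by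
  rw [angleTerm_swap, angleTerm_neg_left hn, angleTerm_swap]

lemma angleTerm_zero_left (hn : 0 < n) (w : E2) : angleTerm n (0, w) = 0 := by
  simp [angleTerm, hn.ne']

lemma angleTerm_zero_right (hn : 0 < n) (v : E2) : angleTerm n (v, 0) = 0 := by
  simp [angleTerm, hn.ne']

/-- A half plane, containing exactly one of `v` and `-v` for each `v ≠ 0`. -/
def upperHalf (v : E2) : Prop := 0 < v 1 ∨ v 1 = 0 ∧ 0 < v 0

lemma upperHalf_neg_iff {v : E2} (hv : v ≠ 0) : upperHalf (-v) ↔ ¬ upperHalf v := by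
  have : v 0 ≠ 0 ∨ v 1 ≠ 0 := by
    by_contra! h
    exact hv (by ext i; fin_cases i; exacts [h.1, h.2])
  simp only [upperHalf, PiLp.neg_apply, Left.neg_pos_iff, neg_eq_zero, not_or, not_and, not_lt]
  constructor
  · rintro (h | ⟨h, h'⟩)
    · exact ⟨h.le, fun h' => absurd h' h.ne⟩
    · exact ⟨h.le, fun _ => h'.le⟩
  · rintro ⟨h, h'⟩
    rcases h.lt_or_eq with h1 | h1
    · exact Or.inl h1
    · exact Or.inr ⟨h1, lt_of_le_of_ne (h' h1) (this.resolve_right (not_not.mpr h1))⟩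

/-- If an involution preserves a finite sum and its summands, and `P` selects one point of each
orbit that contributes, then the sum is twice the sum over the selected points. -/
lemma sum_eq_two_mul_sum_filter {α : Type*} (T : Finset α) (σ : α → α)
    (hσ : Function.Involutive σ) (hT : ∀ x ∈ T, σ x ∈ T) (P : α → Prop) [DecidablePred P]
    (f : α → ℝ) (hf : ∀ x, f (σ x) = f x) (hP : ∀ x, f x ≠ 0 → (P (σ x) ↔ ¬ P x)) :
    ∑ x ∈ T, f x = 2 * ∑ x ∈ T with P x, f x := by
  have h1 : ∑ x ∈ T, (if P (σ x) then f x else 0) = ∑ x ∈ T, if P x then f x else 0 :=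
    Finset.sum_nbij' σ σ hT hT (fun x _ => hσ x) (fun x _ => hσ x) fun x _ => by rw [hf]
  rw [two_mul, Finset.sum_filter]
  nth_rewrite 2 [← h1]
  rw [← Finset.sum_add_distrib]
  refine Finset.sum_congr rfl fun x _ => ?_
  by_cases h0 : f x = 0
  · simp [h0]
  · by_cases hx : P x
    · simp [hx, hP x h0]
    · simp [hx, hP x h0]

/-- The coefficients `a_m` are divisible by `4`: the four choices of signs contribute equally, and
the remaining sum is invariant under swapping the two vectors, twice each term as well as every
diagonal term being an integer. -/
lemma exists_int_angleCoeff (hn : 0 < n) (hint : IsIntegralLattice Λ) {m : ℕ}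
    (hfin : (pairsOfLength Λ m).Finite) : ∃ z : ℤ, angleCoeff n Λ m = 4 * z := by
  classical
  set T := hfin.toFinset with hT
  have hmem : ∀ p, p ∈ T ↔ p ∈ pairsOfLength Λ m := fun p => by rw [hT, Set.Finite.mem_toFinset]
  have h0 : angleCoeff n Λ m = ∑ p ∈ T, angleTerm n p :=
    finsum_mem_eq_finite_toFinset_sum _ hfin
  rw [h0, sum_eq_two_mul_sum_filter T (fun p => (-p.1, p.2)) (fun p => by simp)
    (fun p hp => by
      rw [hmem] at hp ⊢
      exact ⟨Λ.neg_mem hp.1, hp.2.1, by rw [norm_neg]; exact hp.2.2⟩)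
    (fun p => upperHalf p.1) (angleTerm n) (fun p => angleTerm_neg_left hn _ _)
    (fun p hp => upperHalf_neg_iff fun h => hp (by
      rw [show p = (0, p.2) from Prod.ext h rfl, angleTerm_zero_left hn])),
    sum_eq_two_mul_sum_filter _ (fun p => (p.1, -p.2)) (fun p => by simp)
    (fun p hp => by
      rw [Finset.mem_filter, hmem] at hp ⊢
      exact ⟨⟨hp.1.1, Λ.neg_mem hp.1.2.1, by rw [norm_neg]; exact hp.1.2.2⟩, hp.2⟩)
    (fun p => upperHalf p.2) (angleTerm n) (fun p => angleTerm_neg_right hn _ _)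
    (fun p hp => upperHalf_neg_iff fun h => hp (by
      rw [show p = (p.1, 0) from Prod.ext rfl h, angleTerm_zero_right hn])),
    Finset.filter_filter]
  set T' := T.filter fun p => upperHalf p.1 ∧ upperHalf p.2 with hT'
  -- in `ℝ / ℤ` the terms off the diagonal cancel in pairs
  have hsum : ∑ p ∈ T', ((angleTerm n p : ℝ) : AddCircle (1 : ℝ)) = 0 := by
    have hzero : ∀ x : ℝ, (∃ z : ℤ, x = z) → (x : AddCircle (1 : ℝ)) = 0 := by
      rintro x ⟨z, rfl⟩
      rw [AddCircle.coe_eq_zero_iff]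
      exact ⟨z, by simp⟩
    refine Finset.sum_involution (fun p _ => (p.2, p.1)) ?_ ?_ ?_ ?_
    · rintro ⟨v, w⟩ hp
      rw [hT', Finset.mem_filter, hmem] at hp
      rw [angleTerm_swap w v, ← AddCircle.coe_add, ← two_mul]
      exact hzero _ (exists_int_two_mul_angleTerm hn hint hp.1.1 hp.1.2.1)
    · rintro ⟨v, w⟩ hp hne heq
      rw [hT', Finset.mem_filter, hmem] at hp
      obtain rfl : w = v := congrArg Prod.fst heq
      obtain ⟨a, ha⟩ := hint w hp.1.1
      refine hne (hzero _ ⟨(a : ℤ) ^ (2 * n), ?_⟩)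
      rw [angleTerm_self hn, ha]
      push_cast
      rfl
    · rintro ⟨v, w⟩ hp
      rw [hT', Finset.mem_filter, hmem] at hp ⊢
      exact ⟨⟨hp.1.2.1, hp.1.1, (add_comm _ _).trans hp.1.2.2⟩, hp.2.2, hp.2.1⟩
    · rintro ⟨v, w⟩ hp
      rfl
  have hsum' : ((∑ p ∈ T', angleTerm n p : ℝ) : AddCircle (1 : ℝ)) = 0 := by
    rw [← hsum]
    exact map_sum (QuotientAddGroup.mk' (AddSubgroup.zmultiples (1 : ℝ))) _ _
  rw [AddCircle.coe_eq_zero_iff] at hsum'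
  obtain ⟨z, hz⟩ := hsum'
  refine ⟨z, ?_⟩
  rw [← hz]
  simp
  ring

lemma angleCoeff_eq_zero_of_lt (hn : 0 < n) {k m : ℕ} (hk : HasMinimalLength Λ k)
    (hint : IsIntegralLattice Λ) (hm : m < 2 * k) : angleCoeff n Λ m = 0 := by
  have hlow : ∀ v ∈ Λ, v ≠ 0 → (k : ℝ) ≤ ‖v‖ ^ 2 := by
    intro v hv hv0
    obtain ⟨a, ha⟩ := hint v hv
    rw [ha]
    exact_mod_cast hk.2 ⟨v, hv, hv0, ha⟩
  refine (finsum_mem_congr rfl fun p hp => ?_).trans (finsum_mem_zero _)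
  change angleTerm n (p.1, p.2) = 0
  by_cases h1 : p.1 = 0
  · rw [h1, angleTerm_zero_left hn]
  by_cases h2 : p.2 = 0
  · rw [h2, angleTerm_zero_right hn]
  exfalso
  have := add_le_add (hlow _ hp.1 h1) (hlow _ hp.2.1 h2)
  rw [hp.2.2] at this
  have : k + k ≤ m := by exact_mod_cast this
  omega

lemma exists_powerSeries (hn : 0 < n) (hint : IsIntegralLattice Λ) {k : ℕ}
    (hk : HasMinimalLength Λ k) (hfin : ∀ m, (pairsOfLength Λ m).Finite) :
    ∃ g : PowerSeries ℤ, g ∈ Ideal.span {(4 * PowerSeries.X ^ (2 * k) : PowerSeries ℤ)} ∧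
      ∀ m : ℕ, angleCoeff n Λ m = ((PowerSeries.coeff m g : ℤ) : ℝ) := by
  choose b hb using fun m => exists_int_angleCoeff hn hint (hfin m)
  refine ⟨4 * PowerSeries.X ^ (2 * k) * PowerSeries.mk fun m => b (m + 2 * k),
    Ideal.mem_span_singleton.mpr (dvd_mul_right _ _), fun m => ?_⟩
  rw [mul_assoc, show (4 : PowerSeries ℤ) = PowerSeries.C 4 from rfl, PowerSeries.coeff_C_mul,
    PowerSeries.coeff_X_pow_mul']
  split_ifs with h
  · rw [PowerSeries.coeff_mk, Nat.sub_add_cancel h, hb]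
    push_cast
    rfl
  · rw [angleCoeff_eq_zero_of_lt hn hk hint (not_le.mp h)]
    simp

end Lattice

/-! ### Coordinates on a lattice in the plane -/

section Lattice

variable (Λ : Submodule ℤ E2) [DiscreteTopology Λ]

lemma finite_pairsOfLength (m : ℕ) : (pairsOfLength Λ m).Finite := by
  have hd : DiscreteTopology Λ.toAddSubgroup := inferInstanceAs (DiscreteTopology Λ)
  have hclosed : IsClosed (Λ : Set E2) := AddSubgroup.isClosed_of_discrete (H := Λ.toAddSubgroup)
  have hfin : (Metric.closedBall (0 : E2) (Real.sqrt m) ∩ Λ).Finite :=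
    Metric.finite_isBounded_inter_isClosed ⟨‹DiscreteTopology Λ›⟩ Metric.isBounded_closedBall hclosed
  refine (hfin.prod hfin).subset fun p hp => ⟨⟨?_, hp.1⟩, ⟨?_, hp.2.1⟩⟩
  · rw [mem_closedBall_zero_iff]
    exact Real.le_sqrt_of_sq_le (by rw [← hp.2.2]; linarith [sq_nonneg ‖p.2‖])
  · rw [mem_closedBall_zero_iff]
    exact Real.le_sqrt_of_sq_le (by rw [← hp.2.2]; linarith [sq_nonneg ‖p.1‖])

variable [IsZLattice ℝ Λ]

/-- A `ℤ`-basis of a plane lattice, independent over `ℝ`, with the coordinates it provides. -/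
lemma exists_lattice_basis : ∃ (b₁ b₂ : E2) (E : ℤ × ℤ ≃ Λ), b₁ ∈ Λ ∧ b₂ ∈ Λ ∧
    LinearIndependent ℝ ![b₁, b₂] ∧ ∀ p : ℤ × ℤ, (E p : E2) = (p.1 : ℝ) • b₁ + (p.2 : ℝ) • b₂ := by
  have hrank : Module.finrank ℤ Λ = 2 := by
    rw [ZLattice.rank ℝ Λ, finrank_euclideanSpace_fin]
  have := ZLattice.module_free ℝ Λ
  have := ZLattice.module_finite ℝ Λ
  let b : Module.Basis (Fin 2) ℤ Λ := Module.finBasisOfFinrankEq ℤ Λ hrank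
  have hli := (b.ofZLatticeBasis ℝ Λ).linearIndependent
  refine ⟨b 0, b 1, (finTwoArrowEquiv ℤ).symm.trans b.equivFun.symm.toEquiv, (b 0).2, (b 1).2,
    ?_, fun p => ?_⟩
  · have hb : ![(b 0 : E2), b 1] = b.ofZLatticeBasis ℝ Λ := by
      funext i
      fin_cases i <;> simp
    rw [hb]
    exact hli
  · rw [Int.cast_smul_eq_zsmul ℝ, Int.cast_smul_eq_zsmul ℝ]
    simp [Module.Basis.equivFun_symm_apply, Fin.sum_univ_two]

end Lattice

/-- The Gram data of an integral lattice given by an independent pair of vectors. -/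
lemma exists_isNormForm {Λ : Submodule ℤ E2} (hint : IsIntegralLattice Λ) {b₁ b₂ : E2}
    (h₁ : b₁ ∈ Λ) (h₂ : b₂ ∈ Λ) (hli : LinearIndependent ℝ ![b₁, b₂]) :
    ∃ A B C : ℤ, ‖b₁‖ ^ 2 = A ∧ 2 * ⟪b₁, b₂⟫ = (B : ℝ) ∧ ‖b₂‖ ^ 2 = C ∧
      IsNormForm (toComplex b₁) (toComplex b₂) A B C := by
  obtain ⟨A, hA⟩ := hint b₁ h₁
  obtain ⟨C, hC⟩ := hint b₂ h₂
  obtain ⟨S, hS⟩ := hint (b₁ + b₂) (Λ.add_mem h₁ h₂)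
  have hB : 2 * ⟪b₁, b₂⟫ = ((S - A - C : ℤ) : ℝ) := by
    push_cast
    rw [← hA, ← hS, ← hC, norm_add_sq_real]; ring
  refine ⟨A, S - A - C, C, by rw [hA]; rfl, hB, by rw [hC]; rfl, ?_, ?_, ?_, ?_⟩
  · rw [Complex.mul_conj, Complex.normSq_eq_norm_sq, norm_toComplex, hA]; rfl
  · have := Complex.add_conj (toComplex b₁ * starRingEnd ℂ (toComplex b₂))
    rw [toComplex_mul_conj_re, hB, map_mul, Complex.conj_conj] at this
    exact this.symm
  · rw [Complex.mul_conj, Complex.normSq_eq_norm_sq, norm_toComplex, hC]; rfl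
  · rw [← hB, Int.cast_natCast, Int.cast_natCast, ← hA, ← hC]
    rw [LinearIndependent.pair_iff] at hli
    by_contra! hle
    -- the squared norm of the component of `b₁` orthogonal to `b₂`, suitably scaled
    have hv : ‖(2 * ‖b₂‖ ^ 2) • b₁ + (-(2 * ⟪b₁, b₂⟫)) • b₂‖ ^ 2 =
        ‖b₂‖ ^ 2 * (4 * ‖b₁‖ ^ 2 * ‖b₂‖ ^ 2 - (2 * ⟪b₁, b₂⟫) ^ 2) := by
      rw [norm_add_sq_real, norm_smul, norm_smul, inner_smul_left, inner_smul_right, mul_pow,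
        mul_pow, Real.norm_eq_abs, Real.norm_eq_abs, sq_abs, sq_abs]
      simp only [RCLike.conj_to_real]
      ring
    have h0 : (2 * ‖b₂‖ ^ 2) • b₁ + (-(2 * ⟪b₁, b₂⟫)) • b₂ = 0 := by
      rw [← norm_eq_zero, ← sq_eq_zero_iff]
      refine le_antisymm ?_ (sq_nonneg _)
      rw [hv]
      exact mul_nonpos_of_nonneg_of_nonpos (sq_nonneg _) hle
    have hb : b₂ = 0 := by
      have := (hli _ _ h0).1
      simpa using this
    have := (hli 0 1 (by simp [hb])).2
    exact one_ne_zero this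

/-- The level condition evaluated on the dual vectors with coordinates `(1, 0)`, `(0, 1)` and
`(1, 1)`: the level times the dual form has integral coefficients. -/
lemma exists_dual_coeffs_of_level {Λ : Submodule ℤ E2} {N : ℕ} (hN : HasLevel Λ N) {b₁ b₂ : E2}
    {E : ℤ × ℤ ≃ Λ} (hE : ∀ p : ℤ × ℤ, (E p : E2) = (p.1 : ℝ) • b₁ + (p.2 : ℝ) • b₂)
    {A B C : ℤ} (hA : ‖b₁‖ ^ 2 = A) (hB : 2 * ⟪b₁, b₂⟫ = (B : ℝ)) (hC : ‖b₂‖ ^ 2 = C)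
    (hD : 0 < 4 * A * C - B ^ 2) :
    ∃ A' B' C' : ℤ, (4 * A * C - B ^ 2) * A' = N * A ∧ (4 * A * C - B ^ 2) * B' = N * B ∧
      (4 * A * C - B ^ 2) * C' = N * C := by
  have hDR : (4 * A * C - B ^ 2 : ℝ) ≠ 0 := by exact_mod_cast hD.ne'
  have key : ∀ ν₁ ν₂ : ℤ, ∃ z : ℤ,
      (4 * A * C - B ^ 2) * z = N * (C * ν₁ ^ 2 - B * ν₁ * ν₂ + A * ν₂ ^ 2) := by
    intro ν₁ ν₂
    set x : ℝ := (2 * C * ν₁ - B * ν₂) / (4 * A * C - B ^ 2) with hx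
    set y : ℝ := (-B * ν₁ + 2 * A * ν₂) / (4 * A * C - B ^ 2) with hy
    have hinner : ∀ s t : ℝ, 2 * ⟪x • b₁ + y • b₂, s • b₁ + t • b₂⟫ = s * ν₁ + t * ν₂ := by
      intro s t
      have : 2 * ⟪x • b₁ + y • b₂, s • b₁ + t • b₂⟫ =
          2 * x * s * ‖b₁‖ ^ 2 + (x * t + y * s) * (2 * ⟪b₁, b₂⟫) + 2 * y * t * ‖b₂‖ ^ 2 := by
        simp only [inner_add_left, inner_add_right, inner_smul_left, inner_smul_right,
          RCLike.conj_to_real, real_inner_self_eq_norm_sq, real_inner_comm b₁ b₂]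
        ring
      have hx' : (4 * A * C - B ^ 2 : ℝ) * x = 2 * C * ν₁ - B * ν₂ := mul_div_cancel₀ _ hDR
      have hy' : (4 * A * C - B ^ 2 : ℝ) * y = -B * ν₁ + 2 * A * ν₂ := mul_div_cancel₀ _ hDR
      rw [this, hA, hB, hC]
      refine mul_left_cancel₀ hDR ?_
      linear_combination (2 * s * A + t * B) * hx' + (s * B + 2 * t * C) * hy'
    have hmem : x • b₁ + y • b₂ ∈ polarDual Λ := by
      intro γ hγ
      obtain ⟨p, hp⟩ := E.surjective ⟨γ, hγ⟩
      refine ⟨p.1 * ν₁ + p.2 * ν₂, ?_⟩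
      have hγ' : γ = (p.1 : ℝ) • b₁ + (p.2 : ℝ) • b₂ := by rw [← hE, hp]
      rw [hγ', hinner]
      push_cast
      ring
    obtain ⟨z, hz⟩ := hN.1.2 _ hmem
    refine ⟨z, ?_⟩
    have hnorm : 2 * ‖x • b₁ + y • b₂‖ ^ 2 = x * ν₁ + y * ν₂ := by
      rw [← real_inner_self_eq_norm_sq, hinner]
    have : ((4 * A * C - B ^ 2 : ℝ)) * z = N * (C * ν₁ ^ 2 - B * ν₁ * ν₂ + A * ν₂ ^ 2) := by
      rw [← hz, show ‖x • b₁ + y • b₂‖ ^ 2 = (x * ν₁ + y * ν₂) / 2 by linarith, hx, hy]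
      field_simp
      ring
    exact_mod_cast this
  obtain ⟨C', hC'⟩ := key 1 0
  obtain ⟨A', hA'⟩ := key 0 1
  obtain ⟨z, hz⟩ := key 1 1
  exact ⟨A', A' + C' - z, C', by linarith, by linarith, by linarith⟩

lemma toComplex_coord {Λ : Submodule ℤ E2} {b₁ b₂ : E2} {E : ℤ × ℤ ≃ Λ}
    (hE : ∀ p : ℤ × ℤ, (E p : E2) = (p.1 : ℝ) • b₁ + (p.2 : ℝ) • b₂) (p : ℤ × ℤ) :
    toComplex (E p) = p.1 * toComplex b₁ + p.2 * toComplex b₂ := by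
  rw [hE, toComplex_add, toComplex_smul, toComplex_smul]
  simp

lemma summable_of_coord {Λ : Submodule ℤ E2} {b₁ b₂ : E2} {E : ℤ × ℤ ≃ Λ}
    (hE : ∀ p : ℤ × ℤ, (E p : E2) = (p.1 : ℝ) • b₁ + (p.2 : ℝ) • b₂) {A B C : ℝ}
    (h : IsNormForm (toComplex b₁) (toComplex b₂) A B C) (n : ℕ) (τ : UpperHalfPlane) :
    Summable fun γ : Λ => ‖(γ : E2)‖ ^ (2 * n) * ‖qPow τ (‖(γ : E2)‖ ^ 2)‖ := by
  rw [← E.summable_iff]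
  refine (h.summable_planarTheta (2 * n) τ.im_pos).congr fun p => ?_
  rw [Function.comp_apply, ← toComplex_coord hE, norm_mul, norm_pow, norm_toComplex, mul_comm,
    qPow, mul_assoc (2 * Real.pi * Complex.I)]

/-- `Θ_{nn,Λ} = (Θ_{h₁} + iΘ_{h₂}) (Θ_{h₁} - iΘ_{h₂})` is a product of two conjugate planar theta
series. -/
lemma thetaNN_eq_planarTheta_mul {Λ : Submodule ℤ E2} {b₁ b₂ : E2} {E : ℤ × ℤ ≃ Λ}
    (hE : ∀ p : ℤ × ℤ, (E p : E2) = (p.1 : ℝ) • b₁ + (p.2 : ℝ) • b₂) {A B C : ℝ}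
    (h : IsNormForm (toComplex b₁) (toComplex b₂) A B C) (n : ℕ) (τ : UpperHalfPlane) :
    thetaNN n Λ τ = planarTheta (toComplex b₁) (toComplex b₂) (2 * n) τ *
      planarTheta (starRingEnd ℂ (toComplex b₁)) (starRingEnd ℂ (toComplex b₂)) (2 * n) τ := by
  have hs := summable_of_coord hE h n τ
  have s1 : Summable fun p : ℤ × ℤ => thetaTerm (h1 n) τ (E p : E2) :=
    E.summable_iff.mpr (summable_norm_thetaTerm (abs_h1_le n) hs).of_norm
  have s2 : Summable fun p : ℤ × ℤ => thetaTerm (h2 n) τ (E p : E2) :=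
    E.summable_iff.mpr (summable_norm_thetaTerm (abs_h2_le n) hs).of_norm
  have e1 : sphericalTheta (h1 n) Λ τ = ∑' p, thetaTerm (h1 n) τ (E p) := (E.tsum_eq _).symm
  have e2 : sphericalTheta (h2 n) Λ τ = ∑' p, thetaTerm (h2 n) τ (E p) := (E.tsum_eq _).symm
  have hplus : sphericalTheta (h1 n) Λ τ + Complex.I * sphericalTheta (h2 n) Λ τ =
      planarTheta (toComplex b₁) (toComplex b₂) (2 * n) τ := by
    rw [e1, e2, ← tsum_mul_left, ← Summable.tsum_add s1 (s2.mul_left _), planarTheta]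
    refine tsum_congr fun p => ?_
    rw [← toComplex_coord hE, norm_toComplex, thetaTerm, thetaTerm, h1_eq, h2_eq]
    nth_rewrite 3 [← Complex.re_add_im (toComplex (E p) ^ (2 * n))]
    rw [mul_assoc (2 * Real.pi * Complex.I)]
    ring
  have hminus : sphericalTheta (h1 n) Λ τ - Complex.I * sphericalTheta (h2 n) Λ τ =
      planarTheta (starRingEnd ℂ (toComplex b₁)) (starRingEnd ℂ (toComplex b₂)) (2 * n) τ := by
    rw [e1, e2, ← tsum_mul_left, ← Summable.tsum_sub s1 (s2.mul_left _), planarTheta]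
    refine tsum_congr fun p => ?_
    have hc : (p.1 : ℂ) * starRingEnd ℂ (toComplex b₁) + p.2 * starRingEnd ℂ (toComplex b₂) =
        starRingEnd ℂ (toComplex (E p)) := by
      rw [toComplex_coord hE]
      simp
    rw [hc, Complex.norm_conj, norm_toComplex, thetaTerm, thetaTerm, h1_eq, h2_eq, ← map_pow]
    have : starRingEnd ℂ (toComplex (E p) ^ (2 * n)) =
        ((toComplex (E p) ^ (2 * n)).re : ℂ) - (toComplex (E p) ^ (2 * n)).im * Complex.I := by
      apply Complex.ext <;> simp [-map_pow]
    rw [this, mul_assoc (2 * Real.pi * Complex.I)]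
    ring
  rw [← hplus, ← hminus, thetaNN]
  linear_combination (sphericalTheta (h2 n) Λ τ ^ 2) * Complex.I_sq

end LatticeTheta

end

open LatticeTheta in
theorem theorem3p1 (n : ℕ) (hn : 0 < n) :
    IsHarmonicHomogeneous (2 * n) (h1 n) ∧ IsHarmonicHomogeneous (2 * n) (h2 n) ∧
    ∀ (Λ : Submodule ℤ E2) [DiscreteTopology Λ] [IsZLattice ℝ Λ] (N k : ℕ),
      IsIntegralLattice Λ → HasLevel Λ N → HasMinimalLength Λ k →
      -- the two spherical theta series converge absolutely
      (∀ τ : UpperHalfPlane, Summable (fun γ : Λ => thetaTerm (h1 n) τ (γ : E2)) ∧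
        Summable (fun γ : Λ => thetaTerm (h2 n) τ (γ : E2))) ∧
      -- modularity: weight `4n + 2`, group `Γ₀(N)`, trivial character
      (∃ f : ModularForm (CongruenceSubgroup.Gamma0 N) (4 * (n : ℤ) + 2),
        ∀ τ : UpperHalfPlane, f τ = thetaNN n Λ τ) ∧
      -- invariance under `O(2)`
      (∀ φ : E2 ≃ₗᵢ[ℝ] E2, thetaNN n (rotate φ Λ) = thetaNN n Λ) ∧
      -- the `q`-expansion
      (∀ m : ℕ, (pairsOfLength Λ m).Finite) ∧
      (∀ τ : UpperHalfPlane,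
        HasSum (fun m : ℕ => (angleCoeff n Λ m : ℂ) *
          Complex.exp (2 * Real.pi * Complex.I * (τ : ℂ)) ^ m) (thetaNN n Λ τ)) ∧
      -- membership in the ideal `(4q^(2k))` of `ℤ⟦q⟧`
      (∃ g : PowerSeries ℤ, g ∈ Ideal.span {(4 * PowerSeries.X ^ (2 * k) : PowerSeries ℤ)} ∧
        ∀ m : ℕ, angleCoeff n Λ m = ((PowerSeries.coeff m g : ℤ) : ℝ)) := by
  refine ⟨isHarmonicHomogeneous_h1 n, isHarmonicHomogeneous_h2 n, ?_⟩
  intro Λ _ _ N k hint hN hk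
  obtain ⟨b₁, b₂, E, hb₁, hb₂, hli, hE⟩ := exists_lattice_basis Λ
  obtain ⟨A, B, C, hA, hB, hC, hform⟩ := exists_isNormForm hint hb₁ hb₂ hli
  obtain ⟨A', B', C', hA', hB', hC'⟩ := exists_dual_coeffs_of_level hN hE hA hB hC
    (by exact_mod_cast hform.disc_pos)
  have hs := summable_of_coord hE hform n
  have hfin := finite_pairsOfLength Λ
  refine ⟨fun τ => ⟨(summable_norm_thetaTerm (abs_h1_le n) (hs τ)).of_norm,
    (summable_norm_thetaTerm (abs_h2_le n) (hs τ)).of_norm⟩, ?_,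
    fun φ => funext fun τ => thetaNN_rotate hn (hs τ) φ, hfin,
    fun τ => hasSum_angleCoeff hn hint hfin (hs τ), exists_powerSeries hn hint hk hfin⟩
  have : NeZero N := ⟨hN.1.1.ne'⟩
  obtain ⟨f, hf⟩ := hform.exists_modularForm hA' hB' hC' (2 * n)
  have hw : 2 * ((2 * n : ℕ) : ℤ) + 2 = 4 * (n : ℤ) + 2 := by push_cast; ring
  rw [← hw]
  exact ⟨f, fun τ => by rw [hf, thetaNN_eq_planarTheta_mul hE hform]⟩
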